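/- Let $A\in\mathbb{R}^{n\times n}$ be symmetric positive semidefinite, $b\in\mathbb{R}^n$, $\tau\ge 0$, $f(x)=\frac12x^TAx-b^Tx$ and $F(x)=f(x)+\tau\|x\|_1$, and assume that $F$ has a minimizer over $\mathbb{R}^n$. Let $x^0\in\mathbb{R}^n$, $\eta_0>0$, $\rho>1$, $\varepsilon\ge 0$. Here $\|\cdot\|$ is the Euclidean norm (for matrices, the spectral norm). **Notation.** Let $I_0(x)=\{i:x_i=0\}$, $I_0^c(x)=\{i:x_i\ne0\}$, $I_-(x)=\{i:x_i<0\}$, $I_+(x)=\{i:x_i>0\}$. Let $v(x)$ be the minimum-norm subgradient of $F$ at $x$: $v_i(x)=\nabla_if(x)+\tau\,\mathrm{sgn}(x_i)$ if $x_i\neq0$, and $v_i(x)=\min(\nabla_if(x)+\tau,\max(0,\nabla_if(x)-\tau))$ if $x_i=0$. Let $v^p(x)$ agree with $v(x)$ on $I_0(x)$ and vanish elsewhere. Let $c(x;\tau)\in\{-\tau,0,\tau\}^n$ have $i$-th entry $\tau$ if $x_i>0$ or ($x_i=0$ and $\nabla_if(x)+\tau<0$), entry $-\tau$ if $x_i<0$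 or ($x_i=0$ and $\nabla_if(x)-\tau>0$), and entry $0$ otherwise. **Subroutine** $y=\mathrm{TPCG1}(A,b,c,J_0,J_-,J_+,x^0,\delta)$, where $J_0,J_-,J_+$ partition $\{1,\dots,n\}$. Let $\Omega=\{x: x_j=0\ (j\in J_0),\ x_j\le0\ (j\in J_-),\ x_j\ge0\ (j\in J_+)\}$ and let $P$ be the projection onto $\{x:x_j=0,\ j\in J_0\}$. Set $r^0=Ax^0-b+c$, $p^0=P(r^0)$, $d^0=-p^0$. For $k=0,1,\dots$: let $\alpha^{cg}_k=\|p^k\|^2/((d^k)^TAd^k)$ (which is $\infty$ if $p^k\ne0$ and $(d^k)^TAd^k=0$), $\alpha^{tc}_k=\max\{\alpha:x^k+\alpha d^k\in\Omega\}$ (possibly $\infty$), $\alpha_k=\min\{\alpha^{cg}_k,\alpha^{tc}_k\}$ and $x^{k+1}=x^k+\alpha_kd^k$. If $\alpha^{cg}_k>\alpha_k$, return $y=x^{k+1}$. Otherwise let $r^{k+1}=r^k+\alpha_kAd^k$ and $p^{k+1}=P(r^{k+1})$; if $\|p^{k+1}\|_\infty\le\delta$, return $y=x^{k+1}$; else let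 $d^{k+1}=-p^{k+1}+\frac{\|p^{k+1}\|^2}{\|p^k\|^2}d^k$ and continue. **GCG method 3.** Set $\hat\eta=\eta_0$, $\mathcal C=\emptyset$. For $k=0,1,\dots$: if $\|v(x^k)\|_\infty\le\varepsilon$, return $y=x^k$ and stop. Otherwise: - If $\|[v(x^k)]_{I_0(x^k)}\|>\sqrt{\hat\eta}\,\|[v(x^k)]_{I_0^c(x^k)}\|$ and some member of $\mathcal C$ is a subset of $I_0(x^k)$, replace $\hat\eta$ by $\rho\hat\eta$, set $\mathcal C=\emptyset$ and $x^{k+1}=x^k$. - If the same inequality holds but no member of $\mathcal C$ is a subset of $I_0(x^k)$, add $I_0(x^k)$ to $\mathcal C$ and set $x^{k+1}=x^k-\frac{\|v^p(x^k)\|^2}{v^p(x^k)^TAv^p(x^k)}v^p(x^k)$. - If the inequality fails, set $x^{k+1}=\mathrm{TPCG1}\big(A,b,c(x^k;\tau),I_0(x^k),I_-(x^k),I_+(x^k),x^k,\varepsilon/\max(\sqrt{n\hat\eta},1)\big)$. **Error bound.** Let $F^*_x=\min\{F(y): y_i=0\ \text{for all}\ i\in I_0(x)\}$, and let $\eta^*$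 be the smallest $\eta\ge0$ such that $$F(x)-F^*_x\le\frac{\eta}{2\|A\|}\,\big\|[v(x)]_{I_0^c(x)}\big\|^2\qquad\text{for all }x\text{ with }F(x)\le F(x^0),$$ where the inequality is read after multiplication by $2\|A\|$ (so that $\eta^*=0$ if $A=0$). **Theorem.** Such a smallest $\eta^*$ exists. Moreover: (i) GCG method 3 is well defined (including every call of TPCG1, which returns after finitely many steps) and terminates in at most $$\max\left(\left\lceil\frac{\log\eta^*-\log\eta_0}{\log\rho}\right\rceil+1,\,1\right)\big(1+(n+2)(2^n-1)\big)$$ iterations, where an iteration is a pass through its loop, the pass that only returns the output included, and where $\log0=-\infty$, so that the first factor is $1$ if $\eta^*=0$. (ii) The output $y$ satisfies $s\in\partial F(y)$ for some $s$ with $\|s\|_\infty\le\varepsilon$, and if $\varepsilon=0$, then $y$ is a minimizer of $F$. -/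

import Mathlib

open Matrix

noncomputable section

/-! Vectors of `ℝⁿ` are functions `Fin n → ℝ`. On this type `‖x‖` is the max-norm `‖x‖_∞`; the
Euclidean norm is `norm2 x`, and `‖A‖` for a matrix is the Euclidean operator norm `opNorm A`. -/

/-- The Euclidean norm. -/
def norm2 {n : ℕ} (x : Fin n → ℝ) : ℝ := ‖WithLp.toLp 2 x‖

/-- The spectral norm of a square matrix. -/
def opNorm {n : ℕ} (A : Matrix (Fin n) (Fin n) ℝ) : ℝ := ‖Matrix.toEuclideanCLM (𝕜 := ℝ) A‖

/-- The vector that agrees with `x` on `S` and vanishes off `S`: the projection of `x` onto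
`{y : y_j = 0 for j ∉ S}`. Its norms are those of the subvector `x_S`. -/
def coordProj {n : ℕ} (S : Finset (Fin n)) (x : Fin n → ℝ) : Fin n → ℝ :=
  fun i => if i ∈ S then x i else 0

/-! ### The problem -/

/-- The objective `F(x) = ½ xᵀAx - bᵀx + τ‖x‖₁`. -/
def objF {n : ℕ} (A : Matrix (Fin n) (Fin n) ℝ) (b : Fin n → ℝ) (τ : ℝ) (x : Fin n → ℝ) : ℝ :=
  (1 / 2) * (x ⬝ᵥ A *ᵥ x) - b ⬝ᵥ x + τ * ∑ i, |x i|

/-- `x` minimizes `F` over `ℝⁿ`. -/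
def IsOptimal {n : ℕ} (A : Matrix (Fin n) (Fin n) ℝ) (b : Fin n → ℝ) (τ : ℝ)
    (x : Fin n → ℝ) : Prop :=
  ∀ z, objF A b τ x ≤ objF A b τ z

/-- The convex subdifferential `∂F(x)`. -/
def subdiffF {n : ℕ} (A : Matrix (Fin n) (Fin n) ℝ) (b : Fin n → ℝ) (τ : ℝ) (x : Fin n → ℝ) :
    Set (Fin n → ℝ) :=
  {s | ∀ z, objF A b τ x + s ⬝ᵥ (z - x) ≤ objF A b τ z}

/-- The gradient of `f(x) = ½ xᵀAx - bᵀx` (for symmetric `A`). -/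
def gradf {n : ℕ} (A : Matrix (Fin n) (Fin n) ℝ) (b : Fin n → ℝ) (x : Fin n → ℝ) : Fin n → ℝ :=
  A *ᵥ x - b

/-- The minimum-norm subgradient `v(x)` of `F` at `x`. -/
def minSubgrad {n : ℕ} (A : Matrix (Fin n) (Fin n) ℝ) (b : Fin n → ℝ) (τ : ℝ)
    (x : Fin n → ℝ) : Fin n → ℝ :=
  fun i =>
    if x i = 0 then min (gradf A b x i + τ) (max 0 (gradf A b x i - τ))
    else gradf A b x i + τ * Real.sign (x i)

/-- `I₀(x)`. -/
def idxZero {n : ℕ} (x : Fin n → ℝ) : Finset (Fin n) := {i | x i = 0}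

/-- `I₋(x)`. -/
def idxNeg {n : ℕ} (x : Fin n → ℝ) : Finset (Fin n) := {i | x i < 0}

/-- `I₊(x)`. -/
def idxPos {n : ℕ} (x : Fin n → ℝ) : Finset (Fin n) := {i | 0 < x i}

/-- `I₀⁺(x)`. -/
def idxZeroPos {n : ℕ} (A : Matrix (Fin n) (Fin n) ℝ) (b : Fin n → ℝ) (τ : ℝ)
    (x : Fin n → ℝ) : Finset (Fin n) := {i | x i = 0 ∧ gradf A b x i + τ < 0}

/-- `I₀⁻(x)`. -/
def idxZeroNeg {n : ℕ} (A : Matrix (Fin n) (Fin n) ℝ) (b : Fin n → ℝ) (τ : ℝ)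
    (x : Fin n → ℝ) : Finset (Fin n) := {i | x i = 0 ∧ 0 < gradf A b x i - τ}

/-- The vector `c(x; τ)`. -/
def cVec {n : ℕ} (A : Matrix (Fin n) (Fin n) ℝ) (b : Fin n → ℝ) (τ : ℝ)
    (x : Fin n → ℝ) : Fin n → ℝ :=
  fun i =>
    if i ∈ idxPos x ∪ idxZeroPos A b τ x then τ
    else if i ∈ idxNeg x ∪ idxZeroNeg A b τ x then -τ
    else 0

/-- The projected minimum-norm subgradient `v^p(x)`. -/
def projSubgrad {n : ℕ} (A : Matrix (Fin n) (Fin n) ℝ) (b : Fin n → ℝ) (τ : ℝ)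
    (x : Fin n → ℝ) : Fin n → ℝ :=
  coordProj (idxZero x) (minSubgrad A b τ x)

/-! ### The truncated projected CG subroutine TPCG1 -/

/-- The face `Ω = {x : x_j = 0 (j ∈ J₀), x_j ≤ 0 (j ∈ J₋), x_j ≥ 0 (j ∈ J₊)}`. -/
def face {n : ℕ} (J0 Jm Jp : Finset (Fin n)) : Set (Fin n → ℝ) :=
  {x | (∀ j ∈ J0, x j = 0) ∧ (∀ j ∈ Jm, x j ≤ 0) ∧ (∀ j ∈ Jp, 0 ≤ x j)}

/-- The variables `(x^k, r^k, p^k, d^k)` at the start of a pass of the loop of TPCG1. -/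
structure PCGState (n : ℕ) where
  x : Fin n → ℝ
  r : Fin n → ℝ
  p : Fin n → ℝ
  d : Fin n → ℝ

/-- The initial state: `r⁰ = Ax⁰ - b + c`, `p⁰ = P_H(r⁰)`, `d⁰ = -p⁰`. -/
def pcgInit {n : ℕ} (A : Matrix (Fin n) (Fin n) ℝ) (b c : Fin n → ℝ) (J0 : Finset (Fin n))
    (x0 : Fin n → ℝ) : PCGState n where
  x := x0
  r := A *ᵥ x0 - b + c
  p := coordProj J0ᶜ (A *ᵥ x0 - b + c)
  d := -coordProj J0ᶜ (A *ᵥ x0 - b + c)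

/-- The state after a pass with step length `α`. -/
def pcgNext {n : ℕ} (A : Matrix (Fin n) (Fin n) ℝ) (J0 : Finset (Fin n)) (s : PCGState n)
    (α : ℝ) : PCGState n where
  x := s.x + α • s.d
  r := s.r + α • (A *ᵥ s.d)
  p := coordProj J0ᶜ (s.r + α • (A *ᵥ s.d))
  d := -coordProj J0ᶜ (s.r + α • (A *ᵥ s.d)) +
    (norm2 (coordProj J0ᶜ (s.r + α • (A *ᵥ s.d))) ^ 2 / norm2 s.p ^ 2) • s.d

/-- The CG step length `‖p‖² / (dᵀAd)`, which is `∞` if `dᵀAd = 0` (for `p ≠ 0`). -/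
def alphaCG {n : ℕ} (A : Matrix (Fin n) (Fin n) ℝ) (s : PCGState n) : EReal :=
  if s.d ⬝ᵥ A *ᵥ s.d = 0 then ⊤ else ((norm2 s.p ^ 2 / (s.d ⬝ᵥ A *ᵥ s.d) : ℝ) : EReal)

/-- The largest step `max {α : x + α d ∈ Ω}`, which is `∞` if these `α` are not bounded above. -/
def alphaTC {n : ℕ} (J0 Jm Jp : Finset (Fin n)) (s : PCGState n) : EReal :=
  sSup {a : EReal | ∃ α : ℝ, s.x + α • s.d ∈ face J0 Jm Jp ∧ a = (α : EReal)}

/-- The real number `α` is the step length `α_k = min {α^cg, α^tc}` of the pass that starts in `s`.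
There is none if `p = 0` (both quotients of the pass are then undefined) or if the minimum is
infinite. -/
def IsStepLength {n : ℕ} (A : Matrix (Fin n) (Fin n) ℝ) (J0 Jm Jp : Finset (Fin n))
    (s : PCGState n) (α : ℝ) : Prop :=
  s.p ≠ 0 ∧ (α : EReal) = min (alphaCG A s) (alphaTC J0 Jm Jp s)

/-- `TPCG1Loop A J0 Jm Jp ε s y`: the loop of TPCG1, entered in state `s`, is well defined, stops
after finitely many passes, and returns `y`. -/
inductive TPCG1Loop {n : ℕ} (A : Matrix (Fin n) (Fin n) ℝ) (J0 Jm Jp : Finset (Fin n)) (ε : ℝ) :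
    PCGState n → (Fin n → ℝ) → Prop
  | truncate (s : PCGState n) (α : ℝ) (hα : IsStepLength A J0 Jm Jp s α)
      (hcut : (α : EReal) < alphaCG A s) :
      TPCG1Loop A J0 Jm Jp ε s (s.x + α • s.d)
  | finish (s : PCGState n) (α : ℝ) (hα : IsStepLength A J0 Jm Jp s α)
      (hcut : ¬ (α : EReal) < alphaCG A s) (hres : ‖(pcgNext A J0 s α).p‖ ≤ ε) :
      TPCG1Loop A J0 Jm Jp ε s (pcgNext A J0 s α).x
  | next (s : PCGState n) (α : ℝ) (y : Fin n → ℝ) (hα : IsStepLength A J0 Jm Jp s α)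
      (hcut : ¬ (α : EReal) < alphaCG A s) (hres : ¬ ‖(pcgNext A J0 s α).p‖ ≤ ε)
      (hrest : TPCG1Loop A J0 Jm Jp ε (pcgNext A J0 s α) y) :
      TPCG1Loop A J0 Jm Jp ε s y

/-- `y = TPCG1(A, b, c, J₀, J₋, J₊, x⁰, ε)`. -/
def TPCG1Returns {n : ℕ} (A : Matrix (Fin n) (Fin n) ℝ) (b c : Fin n → ℝ)
    (J0 Jm Jp : Finset (Fin n)) (x0 : Fin n → ℝ) (ε : ℝ) (y : Fin n → ℝ) : Prop :=
  TPCG1Loop A J0 Jm Jp ε (pcgInit A b c J0 x0) y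

/-! ### GCG method 3 -/

/-- The test `‖[v(x)]_{I₀(x)}‖ > √η ‖[v(x)]_{I₀ᶜ(x)}‖`. -/
def ReleaseTest {n : ℕ} (A : Matrix (Fin n) (Fin n) ℝ) (b : Fin n → ℝ) (τ η : ℝ)
    (x : Fin n → ℝ) : Prop :=
  norm2 (coordProj (idxZero x) (minSubgrad A b τ x)) >
    √η * norm2 (coordProj (idxZero x)ᶜ (minSubgrad A b τ x))

/-- The variables `(x^k, η̂, 𝒞)` at the start of an iteration. -/
structure GCG3State (n : ℕ) where
  x : Fin n → ℝ
  eta : ℝ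
  C : Finset (Finset (Fin n))

/-- One iteration of GCG method 3 in which the stopping test fails. -/
inductive GCG3Step {n : ℕ} (A : Matrix (Fin n) (Fin n) ℝ) (b : Fin n → ℝ) (τ ρ ε : ℝ) :
    GCG3State n → GCG3State n → Prop
  | raise (s : GCG3State n) (htest : ReleaseTest A b τ s.eta s.x)
      (hC : ∃ S ∈ s.C, S ⊆ idxZero s.x) :
      GCG3Step A b τ ρ ε s ⟨s.x, ρ * s.eta, ∅⟩
  | lineSearch (s : GCG3State n) (htest : ReleaseTest A b τ s.eta s.x)
      (hC : ¬ ∃ S ∈ s.C, S ⊆ idxZero s.x)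
      (hdenom : projSubgrad A b τ s.x ⬝ᵥ A *ᵥ projSubgrad A b τ s.x ≠ 0) :
      GCG3Step A b τ ρ ε s
        ⟨s.x - (norm2 (projSubgrad A b τ s.x) ^ 2 /
            (projSubgrad A b τ s.x ⬝ᵥ A *ᵥ projSubgrad A b τ s.x)) • projSubgrad A b τ s.x,
          s.eta, insert (idxZero s.x) s.C⟩
  | cg (s : GCG3State n) (y : Fin n → ℝ) (htest : ¬ ReleaseTest A b τ s.eta s.x)
      (hy : TPCG1Returns A b (cVec A b τ s.x) (idxZero s.x) (idxNeg s.x) (idxPos s.x) s.x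
        (ε / max (√(n * s.eta)) 1) y) :
      GCG3Step A b τ ρ ε s ⟨y, s.eta, s.C⟩

/-- GCG method 3 with input `(A, b, τ, x⁰, η₀, ρ, ε)` stops at `x^K`, with output `y = x^K`: the
stopping test `‖v(x^k)‖_∞ ≤ ε` fails for all `k < K` and holds for `k = K`. The loop is thus
entered `K + 1` times, the last time only to return `x^K`. -/
def GCG3StopsAt {n : ℕ} (A : Matrix (Fin n) (Fin n) ℝ) (b : Fin n → ℝ) (τ : ℝ) (x0 : Fin n → ℝ)
    (η0 ρ ε : ℝ) (K : ℕ) (y : Fin n → ℝ) : Prop :=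
  ∃ s : ℕ → GCG3State n, s 0 = ⟨x0, η0, ∅⟩ ∧
    (∀ k < K, ¬ ‖minSubgrad A b τ (s k).x‖ ≤ ε ∧ GCG3Step A b τ ρ ε (s k) (s (k + 1))) ∧
    ‖minSubgrad A b τ (s K).x‖ ≤ ε ∧ y = (s K).x

/-! ### The error bound constant and the iteration bound -/

/-- `F*_x = min {F(y) : y_i = 0 for i ∈ I₀(x)}` (attained if `F` is bounded below). -/
def faceMin {n : ℕ} (A : Matrix (Fin n) (Fin n) ℝ) (b : Fin n → ℝ) (τ : ℝ)
    (x : Fin n → ℝ) : ℝ :=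
  sInf (objF A b τ '' {y | ∀ i ∈ idxZero x, y i = 0})

/-- The error bound `F(x) - F*_x ≤ (η / (2‖A‖)) ‖[v(x)]_{I₀ᶜ(x)}‖²` for all `x` with
`F(x) ≤ F(x⁰)`, multiplied by `2‖A‖` so that it also makes sense for `A = 0`. -/
def ErrorBound {n : ℕ} (A : Matrix (Fin n) (Fin n) ℝ) (b : Fin n → ℝ) (τ : ℝ)
    (x0 : Fin n → ℝ) (η : ℝ) : Prop :=
  ∀ x, objF A b τ x ≤ objF A b τ x0 →
    2 * opNorm A * (objF A b τ x - faceMin A b τ x) ≤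
      η * norm2 (coordProj (idxZero x)ᶜ (minSubgrad A b τ x)) ^ 2

/-- `max(⌈(log η* - log η₀) / log ρ⌉ + 1, 1) · (1 + (n+2)(2ⁿ-1))`, where `log 0 = -∞`, so that the
first factor is `1` for `η* = 0`. -/
def gcg3Bound (n : ℕ) (ηs η0 ρ : ℝ) : ℤ :=
  (if ηs = 0 then 1 else max (⌈(Real.log ηs - Real.log η0) / Real.log ρ⌉ + 1) 1) *
    (1 + ((n : ℤ) + 2) * (2 ^ n - 1))

end

noncomputable section

/-! ### Norms and coordinate projections -/

/-! Everything rests on `F` being piecewise quadratic: for a sign pattern with vector `c`, the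
convex quadratic `quadObj A b c` equals `F` on that orthant face.

Error bound. There are finitely many sign patterns, and `exists_quadObj_gap_le` treats each one: a
quadratic with a stationary point on its coordinate subspace has gap at most a constant times the
squared gradient norm, and otherwise the gradient stays away from zero while the gap is bounded on
the level set. The admissible `η` then form a nonempty closed set, which has a least element.

Subroutine. TPCG1 is conjugate gradients on a face. Nonzero projected gradients are mutually
orthogonal, so there are finitely many passes (`PCGInvariant.next`,
`PCGInvariant.exists_TPCG1Loop`). A return never increases `F`; either a further coordinate has
become zero or the free part of `v` is within tolerance (`TPCG1Returns.spec`), and in the latter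
case the outer method stops or the release test holds.

Counting. Consecutive CG calls therefore number at most `n`. Each line search stores a new nonempty
zero set, so at most `2 ^ n - 1` of them fall between two increases of `η̂`. Once `η̂ ≥ η*`, the
line search drops `F` strictly below the minimum over the face it leaves (`objF_lineSearch_lt`); as
`F` never increases, no later iterate lies on that face, and `η̂` is not raised again. Hence `η₀ρʲ <
ρη*` after `j ≥ 1` increases. -/

theorem norm2_nonneg {n : ℕ} (x : Fin n → ℝ) : 0 ≤ norm2 x := norm_nonneg _

theorem norm2_sq {n : ℕ} (x : Fin n → ℝ) : norm2 x ^ 2 = x ⬝ᵥ x := by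
  rw [norm2, EuclideanSpace.real_norm_sq_eq]
  simp [dotProduct, pow_two]

theorem norm2_eq_zero {n : ℕ} {x : Fin n → ℝ} : norm2 x = 0 ↔ x = 0 := by
  simp [norm2]

theorem norm2_pos {n : ℕ} {x : Fin n → ℝ} (hx : x ≠ 0) : 0 < norm2 x :=
  (norm2_nonneg x).lt_of_ne fun h => hx (norm2_eq_zero.1 h.symm)

theorem abs_apply_le_norm2 {n : ℕ} (x : Fin n → ℝ) (i : Fin n) : |x i| ≤ norm2 x :=
  PiLp.norm_apply_le (WithLp.toLp 2 x) i

theorem norm_le_norm2 {n : ℕ} (x : Fin n → ℝ) : ‖x‖ ≤ norm2 x :=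
  (pi_norm_le_iff_of_nonneg (norm2_nonneg x)).2 (abs_apply_le_norm2 x)

theorem norm2_le_sqrt_mul_norm {n : ℕ} (x : Fin n → ℝ) : norm2 x ≤ √n * ‖x‖ := by
  refine abs_le_of_sq_le_sq' ?_ (by positivity) |>.2
  rw [mul_pow, Real.sq_sqrt (Nat.cast_nonneg n), norm2_sq, dotProduct]
  calc ∑ i, x i * x i ≤ ∑ _i : Fin n, ‖x‖ ^ 2 := by
        refine Finset.sum_le_sum fun i _ => ?_
        rw [← pow_two, ← sq_abs]
        exact pow_le_pow_left₀ (abs_nonneg _) (norm_le_pi_norm x i) 2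
    _ = n * ‖x‖ ^ 2 := by simp

theorem opNorm_nonneg {n : ℕ} (A : Matrix (Fin n) (Fin n) ℝ) : 0 ≤ opNorm A := norm_nonneg _

theorem dotProduct_mulVec_le_opNorm {n : ℕ} (A : Matrix (Fin n) (Fin n) ℝ) (x : Fin n → ℝ) :
    x ⬝ᵥ A *ᵥ x ≤ opNorm A * norm2 x ^ 2 := by
  have h1 := real_inner_le_norm (WithLp.toLp 2 (A *ᵥ x)) (WithLp.toLp 2 x)
  have h2 := (Matrix.toEuclideanCLM (𝕜 := ℝ) A).le_opNorm (WithLp.toLp 2 x)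
  rw [EuclideanSpace.inner_toLp_toLp, star_trivial] at h1
  rw [Matrix.toEuclideanCLM_toLp] at h2
  calc x ⬝ᵥ A *ᵥ x ≤ ‖WithLp.toLp 2 (A *ᵥ x)‖ * norm2 x := h1
    _ ≤ opNorm A * norm2 x * norm2 x := mul_le_mul_of_nonneg_right h2 (norm2_nonneg x)
    _ = opNorm A * norm2 x ^ 2 := by ring

theorem Matrix.PosSemidef.dotProduct_mulVec_comm {n : ℕ} {A : Matrix (Fin n) (Fin n) ℝ}
    (hA : A.PosSemidef) (x y : Fin n → ℝ) : x ⬝ᵥ A *ᵥ y = y ⬝ᵥ A *ᵥ x := by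
  have h : Aᵀ = A := by simpa [IsHermitian] using hA.1
  rw [Matrix.dotProduct_mulVec, ← Matrix.mulVec_transpose, h, dotProduct_comm]

theorem Matrix.PosSemidef.zero_le_dotProduct_mulVec {n : ℕ} {A : Matrix (Fin n) (Fin n) ℝ}
    (hA : A.PosSemidef) (x : Fin n → ℝ) : 0 ≤ x ⬝ᵥ A *ᵥ x := by
  simpa using hA.dotProduct_mulVec_nonneg x

theorem coordProj_apply_of_mem {n : ℕ} {S : Finset (Fin n)} (x : Fin n → ℝ) {i : Fin n}
    (h : i ∈ S) : coordProj S x i = x i := if_pos h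

theorem coordProj_apply_of_notMem {n : ℕ} {S : Finset (Fin n)} (x : Fin n → ℝ) {i : Fin n}
    (h : i ∉ S) : coordProj S x i = 0 := if_neg h

theorem coordProj_eq_self {n : ℕ} {S : Finset (Fin n)} {x : Fin n → ℝ}
    (h : ∀ i ∉ S, x i = 0) : coordProj S x = x := by
  funext i
  by_cases hi : i ∈ S
  · exact coordProj_apply_of_mem x hi
  · rw [coordProj_apply_of_notMem x hi, h i hi]

theorem coordProj_congr {n : ℕ} {S : Finset (Fin n)} {x y : Fin n → ℝ}
    (h : ∀ i ∈ S, x i = y i) : coordProj S x = coordProj S y := by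
  funext i
  by_cases hi : i ∈ S
  · rw [coordProj_apply_of_mem x hi, coordProj_apply_of_mem y hi, h i hi]
  · rw [coordProj_apply_of_notMem x hi, coordProj_apply_of_notMem y hi]

theorem coordProj_add {n : ℕ} (S : Finset (Fin n)) (x y : Fin n → ℝ) :
    coordProj S (x + y) = coordProj S x + coordProj S y := by
  funext i; by_cases hi : i ∈ S <;> simp [coordProj, hi]

theorem coordProj_sub {n : ℕ} (S : Finset (Fin n)) (x y : Fin n → ℝ) :
    coordProj S (x - y) = coordProj S x - coordProj S y := by
  funext i; by_cases hi : i ∈ S <;> simp [coordProj, hi]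

theorem coordProj_smul {n : ℕ} (S : Finset (Fin n)) (t : ℝ) (x : Fin n → ℝ) :
    coordProj S (t • x) = t • coordProj S x := by
  funext i; by_cases hi : i ∈ S <;> simp [coordProj, hi]

theorem coordProj_dotProduct {n : ℕ} {S : Finset (Fin n)} (x : Fin n → ℝ) {y : Fin n → ℝ}
    (h : ∀ i ∉ S, y i = 0) : coordProj S x ⬝ᵥ y = x ⬝ᵥ y := by
  refine Finset.sum_congr rfl fun i _ => ?_
  by_cases hi : i ∈ S
  · rw [coordProj_apply_of_mem x hi]
  · rw [h i hi, mul_zero, mul_zero]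

theorem coordProj_dotProduct_left {n : ℕ} (S : Finset (Fin n)) (x y : Fin n → ℝ) :
    coordProj S x ⬝ᵥ y = x ⬝ᵥ coordProj S y := by
  refine Finset.sum_congr rfl fun i _ => ?_
  by_cases hi : i ∈ S <;> simp [coordProj, hi]

/-! ### The smooth pieces of the objective -/

/-- The quadratic `½ xᵀAx - bᵀx + cᵀx`, which agrees with `F` on an orthant. -/
def quadObj {n : ℕ} (A : Matrix (Fin n) (Fin n) ℝ) (b c x : Fin n → ℝ) : ℝ :=
  (1 / 2) * (x ⬝ᵥ A *ᵥ x) - b ⬝ᵥ x + c ⬝ᵥ x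

theorem quadObj_add {n : ℕ} {A : Matrix (Fin n) (Fin n) ℝ} (hA : A.PosSemidef)
    (b c x d : Fin n → ℝ) :
    quadObj A b c (x + d) =
      quadObj A b c x + (A *ᵥ x - b + c) ⬝ᵥ d + (1 / 2) * (d ⬝ᵥ A *ᵥ d) := by
  have h1 := hA.dotProduct_mulVec_comm x d
  have h2 := dotProduct_comm (A *ᵥ x) d
  simp only [quadObj, mulVec_add, dotProduct_add, add_dotProduct, sub_dotProduct]
  linarith

theorem quadObj_add_smul {n : ℕ} {A : Matrix (Fin n) (Fin n) ℝ} (hA : A.PosSemidef)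
    (b c x d : Fin n → ℝ) (t : ℝ) :
    quadObj A b c (x + t • d) =
      quadObj A b c x + t * ((A *ᵥ x - b + c) ⬝ᵥ d) + (1 / 2) * t ^ 2 * (d ⬝ᵥ A *ᵥ d) := by
  rw [quadObj_add hA, mulVec_smul, dotProduct_smul, dotProduct_smul, smul_dotProduct]
  simp only [smul_eq_mul]
  ring

theorem objF_eq_quadObj {n : ℕ} (A : Matrix (Fin n) (Fin n) ℝ) (b : Fin n → ℝ) (τ : ℝ)
    {c x : Fin n → ℝ} (h : ∀ i, c i * x i = τ * |x i|) : objF A b τ x = quadObj A b c x := by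
  simp only [objF, quadObj, Finset.mul_sum]
  congr 1
  exact Finset.sum_congr rfl fun i _ => (h i).symm

theorem quadObj_le_objF {n : ℕ} (A : Matrix (Fin n) (Fin n) ℝ) (b : Fin n → ℝ) (τ : ℝ)
    {c x : Fin n → ℝ} (h : ∀ i, x i ≠ 0 → |c i| ≤ τ) : quadObj A b c x ≤ objF A b τ x := by
  simp only [objF, quadObj, Finset.mul_sum]
  gcongr
  refine Finset.sum_le_sum fun i _ => ?_
  by_cases hi : x i = 0
  · simp [hi]
  · calc c i * x i ≤ |c i| * |x i| := by rw [← abs_mul]; exact le_abs_self _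
      _ ≤ τ * |x i| := mul_le_mul_of_nonneg_right (h i hi) (abs_nonneg _)

/-! ### Existence of the error bound constant -/

/-- A section of `L` over its range extends to a generalized inverse `h` with `L h L = L`, and by
symmetry `u ⬝ᵥ L u = L u ⬝ᵥ h (L u)`. This replaces the smallest nonzero eigenvalue. -/
theorem LinearMap.exists_dotProduct_le_mul_norm2_sq {n : ℕ}
    (L : (Fin n → ℝ) →ₗ[ℝ] (Fin n → ℝ)) (hL : ∀ x y, x ⬝ᵥ L y = L x ⬝ᵥ y) :
    ∃ C : ℝ, 0 ≤ C ∧ ∀ u, u ⬝ᵥ L u ≤ C * norm2 (L u) ^ 2 := by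
  obtain ⟨g, hg⟩ := L.rangeRestrict.exists_rightInverse_of_surjective L.range_rangeRestrict
  obtain ⟨h, hh⟩ := LinearMap.exists_extend g
  refine ⟨opNorm (LinearMap.toMatrix' h), opNorm_nonneg _, fun u => ?_⟩
  have h1 : L (h (L u)) = L u := by
    have e1 : h (L u) = g (L.rangeRestrict u) := LinearMap.congr_fun hh (L.rangeRestrict u)
    have e2 := LinearMap.congr_fun hg (L.rangeRestrict u)
    rw [e1]
    exact congrArg Subtype.val e2
  calc u ⬝ᵥ L u = L u ⬝ᵥ h (L u) := by rw [← hL, h1]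
    _ = L u ⬝ᵥ LinearMap.toMatrix' h *ᵥ L u := by rw [LinearMap.toMatrix'_mulVec]
    _ ≤ _ := dotProduct_mulVec_le_opNorm _ _

/-- The range is a closed subspace, so a point outside it has positive distance from it. -/
theorem LinearMap.exists_pos_le_norm2_sub_sq {n : ℕ}
    (L : (Fin n → ℝ) →ₗ[ℝ] (Fin n → ℝ)) {w : Fin n → ℝ} (hw : w ∉ LinearMap.range L) :
    ∃ C : ℝ, 0 < C ∧ ∀ u, C ≤ norm2 (L u - w) ^ 2 := by
  have hcl : IsClosed (LinearMap.range L : Set (Fin n → ℝ)) :=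
    Submodule.closed_of_finiteDimensional _
  have hpos := (hcl.notMem_iff_infDist_pos ⟨0, zero_mem _⟩).1 hw
  refine ⟨_, pow_pos hpos 2, fun u => pow_le_pow_left₀ hpos.le ?_ 2⟩
  calc Metric.infDist w (LinearMap.range L : Set (Fin n → ℝ)) ≤ dist w (L u) :=
        Metric.infDist_le_dist_of_mem ⟨u, rfl⟩
    _ = ‖L u - w‖ := by rw [dist_comm, dist_eq_norm]
    _ ≤ _ := norm_le_norm2 _

/-- The compression of `A` to the coordinates in `S`. -/
def compression {n : ℕ} (A : Matrix (Fin n) (Fin n) ℝ) (S : Finset (Fin n)) :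
    (Fin n → ℝ) →ₗ[ℝ] (Fin n → ℝ) where
  toFun x := coordProj S (A *ᵥ coordProj S x)
  map_add' x y := by rw [coordProj_add, mulVec_add, coordProj_add]
  map_smul' t x := by rw [coordProj_smul, mulVec_smul, coordProj_smul]; rfl

theorem compression_apply {n : ℕ} (A : Matrix (Fin n) (Fin n) ℝ) (S : Finset (Fin n))
    (x : Fin n → ℝ) : compression A S x = coordProj S (A *ᵥ coordProj S x) := rfl

theorem compression_symm {n : ℕ} {A : Matrix (Fin n) (Fin n) ℝ} (hA : A.PosSemidef)
    (S : Finset (Fin n)) (x y : Fin n → ℝ) :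
    x ⬝ᵥ compression A S y = compression A S x ⬝ᵥ y := by
  rw [compression_apply, compression_apply, coordProj_dotProduct_left,
    ← coordProj_dotProduct_left, hA.dotProduct_mulVec_comm, dotProduct_comm]

theorem coordProj_coordProj {n : ℕ} (S : Finset (Fin n)) (x : Fin n → ℝ) :
    coordProj S (coordProj S x) = coordProj S x :=
  coordProj_congr fun _ hi => coordProj_apply_of_mem x hi

/-- A convex quadratic on a coordinate subspace: gaps to values above the quadratic are bounded by
the squared gradient norm, as long as they are bounded. -/
theorem exists_quadObj_gap_le {n : ℕ} {A : Matrix (Fin n) (Fin n) ℝ} (hA : A.PosSemidef)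
    (b c : Fin n → ℝ) (S : Finset (Fin n)) (D : ℝ) :
    ∃ C : ℝ, 0 ≤ C ∧ ∀ x y : Fin n → ℝ, (∀ i ∉ S, x i = 0) → (∀ i ∉ S, y i = 0) →
      ∀ t, quadObj A b c y ≤ t → quadObj A b c x - t ≤ D →
        quadObj A b c x - t ≤ C * norm2 (coordProj S (A *ᵥ x - b + c)) ^ 2 := by
  -- Membership in the range says exactly that the quadratic has a stationary point `z` on the
  -- coordinate subspace. Expanding around `z` makes the gap at most `½(x-z)ᵀA(x-z)`.
  by_cases hw : coordProj S (b - c) ∈ LinearMap.range (compression A S)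
  · obtain ⟨C, hC0, hC⟩ := LinearMap.exists_dotProduct_le_mul_norm2_sq _ (compression_symm hA S)
    obtain ⟨z', hz'⟩ := hw
    refine ⟨C, hC0, fun x y hx hy t ht _ => ?_⟩
    set z := coordProj S z' with hz
    have hzS : ∀ i ∉ S, z i = 0 := fun i hi => coordProj_apply_of_notMem _ hi
    have hgrad : coordProj S (A *ᵥ z - b + c) = 0 := by
      rw [compression_apply, coordProj_sub] at hz'
      rw [coordProj_add, coordProj_sub, hz', sub_sub_cancel_left, neg_add_cancel]
    have hdiff : ∀ u : Fin n → ℝ, (∀ i ∉ S, u i = 0) →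
        quadObj A b c u = quadObj A b c z + (1 / 2) * ((u - z) ⬝ᵥ A *ᵥ (u - z)) := by
      intro u hu
      have huz : ∀ i ∉ S, (u - z) i = 0 := fun i hi => by simp [hu i hi, hzS i hi]
      have := quadObj_add hA b c z (u - z)
      rw [← coordProj_dotProduct _ huz, hgrad, zero_dotProduct, add_zero,
        add_sub_cancel] at this
      exact this
    have h1 := hdiff x hx
    have h2 := hdiff y hy
    have h3 := hA.zero_le_dotProduct_mulVec (y - z)
    have hxz : coordProj S (x - z) = x - z :=
      coordProj_eq_self fun i hi => by simp [hx i hi, hzS i hi]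
    have h4 := hC (x - z)
    have h6 := hA.zero_le_dotProduct_mulVec (x - z)
    have h5 : coordProj S (A *ᵥ x - b + c) = coordProj S (A *ᵥ (x - z)) := by
      rw [← sub_zero (coordProj S (A *ᵥ x - b + c)), ← hgrad, ← coordProj_sub, mulVec_sub]
      congr 1
      abel
    rw [h5]
    rw [compression_apply, hxz, ← coordProj_dotProduct_left, hxz] at h4
    linarith
  · obtain ⟨C, hC0, hC⟩ := LinearMap.exists_pos_le_norm2_sub_sq _ hw
    -- Without a stationary point the squared gradient norm is at least `C`, so the a priori bound
    -- `D` on the gap suffices.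
    refine ⟨max D 0 / C, by positivity, fun x y hx hy t _ hD => ?_⟩
    have h1 := hC x
    rw [compression_apply, coordProj_eq_self hx, ← coordProj_sub, sub_sub_eq_add_sub,
      add_sub_right_comm] at h1
    calc _ ≤ max D 0 := hD.trans (le_max_left _ _)
      _ = max D 0 / C * C := by field_simp
      _ ≤ _ := by gcongr

theorem mem_idxZero {n : ℕ} {x : Fin n → ℝ} {i : Fin n} : i ∈ idxZero x ↔ x i = 0 := by
  simp [idxZero]

theorem minSubgrad_apply_of_ne {n : ℕ} (A : Matrix (Fin n) (Fin n) ℝ) (b : Fin n → ℝ) (τ : ℝ)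
    {x : Fin n → ℝ} {i : Fin n} (h : x i ≠ 0) :
    minSubgrad A b τ x i = (A *ᵥ x - b) i + τ * Real.sign (x i) := if_neg h

theorem Real.sign_mul_self_eq_abs (t : ℝ) : Real.sign t * t = |t| := by
  rcases lt_trichotomy t 0 with h | rfl | h
  · rw [Real.sign_of_neg h, abs_of_neg h]; ring
  · simp
  · rw [Real.sign_of_pos h, abs_of_pos h]; ring

theorem Real.abs_sign_le_one (t : ℝ) : |Real.sign t| ≤ 1 := by
  rcases Real.sign_apply_eq t with h | h | h <;> simp [h]

theorem bddBelow_objF_image {n : ℕ} {A : Matrix (Fin n) (Fin n) ℝ} {b : Fin n → ℝ} {τ : ℝ}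
    (hopt : ∃ x, IsOptimal A b τ x) (s : Set (Fin n → ℝ)) : BddBelow (objF A b τ '' s) := by
  obtain ⟨z, hz⟩ := hopt
  exact ⟨objF A b τ z, by rintro _ ⟨y, -, rfl⟩; exact hz y⟩

theorem faceMin_le {n : ℕ} {A : Matrix (Fin n) (Fin n) ℝ} {b : Fin n → ℝ} {τ : ℝ}
    (hopt : ∃ x, IsOptimal A b τ x) {x y : Fin n → ℝ} (h : ∀ i ∈ idxZero x, y i = 0) :
    faceMin A b τ x ≤ objF A b τ y :=
  csInf_le (bddBelow_objF_image hopt _) ⟨y, h, rfl⟩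

/-- With `c` taken from the signs of `x`, the quadratic equals `F` at `x` and lies below `F`
everywhere, so the gap of `F` is a gap of the quadratic to a value above it. Summing the constants
over all sign patterns makes the bound uniform. -/
theorem exists_objF_sub_faceMin_le {n : ℕ} {A : Matrix (Fin n) (Fin n) ℝ} (hA : A.PosSemidef)
    (b : Fin n → ℝ) {τ : ℝ} (hτ : 0 ≤ τ) (hopt : ∃ x, IsOptimal A b τ x) (x0 : Fin n → ℝ) :
    ∃ C : ℝ, 0 ≤ C ∧ ∀ x, objF A b τ x ≤ objF A b τ x0 →
      objF A b τ x - faceMin A b τ x ≤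
        C * norm2 (coordProj (idxZero x)ᶜ (minSubgrad A b τ x)) ^ 2 := by
  obtain ⟨z, hz⟩ := hopt
  -- The largest possible gap on the level set of `x0`, since `z` is a global minimizer.
  set D := objF A b τ x0 - objF A b τ z
  choose C hC0 hC using fun σ : Fin n → SignType =>
    exists_quadObj_gap_le hA b (fun i => τ * (σ i : ℝ)) {i | σ i ≠ 0} D
  refine ⟨∑ σ, C σ, Finset.sum_nonneg fun σ _ => hC0 σ, fun x hx => ?_⟩
  set σ : Fin n → SignType := fun i => SignType.sign (x i) with hσ
  set c : Fin n → ℝ := fun i => τ * (σ i : ℝ) with hc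
  have hS : (Finset.univ.filter fun i => σ i ≠ 0) = (idxZero x)ᶜ := by
    ext i; simp [hσ, mem_idxZero]
  have hsgn : ∀ i, c i = τ * Real.sign (x i) := by
    intro i
    rcases lt_trichotomy (x i) 0 with h | h | h
    · simp [hc, hσ, sign_neg h, Real.sign_of_neg h]
    · simp [hc, hσ, h]
    · simp [hc, hσ, sign_pos h, Real.sign_of_pos h]
  have hgrad : coordProj (idxZero x)ᶜ (minSubgrad A b τ x) =
      coordProj (idxZero x)ᶜ (A *ᵥ x - b + c) := by
    refine coordProj_congr fun i hi => ?_
    rw [Finset.mem_compl, mem_idxZero] at hi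
    rw [minSubgrad_apply_of_ne A b τ hi, Pi.add_apply, hsgn]
  have hFx : objF A b τ x = quadObj A b c x := objF_eq_quadObj A b τ fun i => by
    rw [hsgn, mul_assoc, Real.sign_mul_self_eq_abs]
  have hle : ∀ y, quadObj A b c y ≤ objF A b τ y := fun y =>
    quadObj_le_objF A b τ fun i _ => by
      rw [hsgn, abs_mul, abs_of_nonneg hτ]
      exact mul_le_of_le_one_right hτ (Real.abs_sign_le_one _)
  have key : ∀ y, (∀ i ∈ idxZero x, y i = 0) → objF A b τ x - objF A b τ y ≤
      C σ * norm2 (coordProj (idxZero x)ᶜ (minSubgrad A b τ x)) ^ 2 := by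
    intro y hy
    have := hC σ x y
    rw [hS, ← hFx] at this
    rw [hgrad]
    refine this (fun i hi => ?_) (fun i hi => ?_) _ (hle y) ?_
    · simpa [mem_idxZero] using hi
    · exact hy i (by simpa using hi)
    · have := hz y; simp only [D]; linarith
  have h1 : objF A b τ x - C σ * norm2 (coordProj (idxZero x)ᶜ (minSubgrad A b τ x)) ^ 2 ≤
      faceMin A b τ x := by
    refine le_csInf ⟨_, 0, fun i _ => rfl, rfl⟩ ?_
    rintro _ ⟨y, hy, rfl⟩
    linarith [key y hy]
  have h2 : C σ ≤ ∑ σ, C σ := Finset.single_le_sum (fun σ _ => hC0 σ) (Finset.mem_univ σ)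
  have h3 := mul_le_mul_of_nonneg_right h2
    (sq_nonneg (norm2 (coordProj (idxZero x)ᶜ (minSubgrad A b τ x))))
  linarith

theorem exists_isLeast_errorBound {n : ℕ} {A : Matrix (Fin n) (Fin n) ℝ} (hA : A.PosSemidef)
    (b : Fin n → ℝ) {τ : ℝ} (hτ : 0 ≤ τ) (hopt : ∃ x, IsOptimal A b τ x) (x0 : Fin n → ℝ) :
    ∃ ηs : ℝ, IsLeast {η : ℝ | 0 ≤ η ∧ ErrorBound A b τ x0 η} ηs := by
  set T := {η : ℝ | 0 ≤ η ∧ ErrorBound A b τ x0 η} with hT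
  have hbdd : BddBelow T := ⟨0, fun η hη => hη.1⟩
  have hne : T.Nonempty := by
    obtain ⟨C, hC0, hC⟩ := exists_objF_sub_faceMin_le hA b hτ hopt x0
    have hn := opNorm_nonneg A
    refine ⟨2 * opNorm A * C, by positivity, fun x hx => ?_⟩
    linarith [mul_le_mul_of_nonneg_left (hC x hx) hn]
  have hclosed : IsClosed T := by
    have : T = Set.Ici 0 ∩ ⋂ x, ⋂ (_ : objF A b τ x ≤ objF A b τ x0),
        {η | 2 * opNorm A * (objF A b τ x - faceMin A b τ x) ≤
          η * norm2 (coordProj (idxZero x)ᶜ (minSubgrad A b τ x)) ^ 2} := by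
      ext η; simp [hT, ErrorBound]
    rw [this]
    exact isClosed_Ici.inter (isClosed_iInter fun x => isClosed_iInter fun _ =>
      isClosed_le continuous_const (continuous_id.mul continuous_const))
  exact ⟨sInf T, hclosed.csInf_mem hne hbdd, fun η hη => csInf_le hbdd hη⟩

/-! ### Subgradients -/

/-- The vector `c = v(x) - ∇f(x)` is a subgradient of `τ‖·‖₁` at `x`. The convex quadratic with this
`c` touches `F` from below at `x`, with gradient `v(x)` there. -/
theorem minSubgrad_mem_subdiffF {n : ℕ} {A : Matrix (Fin n) (Fin n) ℝ} (hA : A.PosSemidef)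
    (b : Fin n → ℝ) {τ : ℝ} (hτ : 0 ≤ τ) (x : Fin n → ℝ) :
    minSubgrad A b τ x ∈ subdiffF A b τ x := by
  intro z
  set c := minSubgrad A b τ x - (A *ᵥ x - b) with hc
  have hci : ∀ i, |c i| ≤ τ ∧ c i * x i = τ * |x i| := by
    intro i
    by_cases hi : x i = 0
    · simp only [hc, minSubgrad, Pi.sub_apply, gradf, hi, mul_zero, abs_zero, and_true, if_true]
      generalize (A *ᵥ x) i - b i = g
      have h1 : g - τ ≤ min (g + τ) (max 0 (g - τ)) :=
        le_min (by linarith) (le_max_right _ _)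
      have h2 := min_le_left (g + τ) (max 0 (g - τ))
      exact abs_le.2 ⟨by linarith, by linarith⟩
    · rw [hc, Pi.sub_apply, minSubgrad_apply_of_ne A b τ hi, add_sub_cancel_left, abs_mul,
        abs_of_nonneg hτ, mul_assoc, Real.sign_mul_self_eq_abs]
      exact ⟨mul_le_of_le_one_right hτ (Real.abs_sign_le_one _), rfl⟩
  have h1 := objF_eq_quadObj A b τ fun i => (hci i).2
  have h2 := quadObj_le_objF A b τ (x := z) fun i _ => (hci i).1
  have h3 := quadObj_add hA b c x (z - x)
  have h4 := hA.zero_le_dotProduct_mulVec (z - x)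
  rw [add_sub_cancel, hc, add_sub_cancel, ← hc] at h3
  linarith

theorem isOptimal_of_minSubgrad_eq_zero {n : ℕ} {A : Matrix (Fin n) (Fin n) ℝ}
    (hA : A.PosSemidef) {b : Fin n → ℝ} {τ : ℝ} (hτ : 0 ≤ τ) {x : Fin n → ℝ}
    (h : minSubgrad A b τ x = 0) : IsOptimal A b τ x := fun z => by
  simpa [h] using minSubgrad_mem_subdiffF hA b hτ x z

/-! ### The conjugate gradient subroutine -/

/-- The invariant of the loop of TPCG1: `W` is the span of the previous (mutually orthogonal)
projected gradients, equivalently of the previous (mutually `A`-conjugate) directions. -/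
structure PCGInvariant {n : ℕ} (A : Matrix (Fin n) (Fin n) ℝ) (b c : Fin n → ℝ)
    (J0 Jm Jp : Finset (Fin n)) (W : Submodule ℝ (Fin n → ℝ)) (s : PCGState n) : Prop where
  x_mem : s.x ∈ face J0 Jm Jp
  r_eq : s.r = A *ᵥ s.x - b + c
  p_eq : s.p = coordProj J0ᶜ s.r
  d_supp : ∀ i ∈ J0, s.d i = 0
  W_supp : ∀ w ∈ W, ∀ i ∈ J0, w i = 0
  p_orth : ∀ w ∈ W, w ⬝ᵥ s.p = 0
  d_conj : ∀ w ∈ W, w ⬝ᵥ A *ᵥ s.d = 0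
  d_add_p_mem : s.d + s.p ∈ W
  krylov : ∀ w ∈ W, coordProj J0ᶜ (A *ᵥ w) ∈ W ⊔ Submodule.span ℝ {s.p}

section

variable {n : ℕ} {A : Matrix (Fin n) (Fin n) ℝ} {b c : Fin n → ℝ} {J0 Jm Jp : Finset (Fin n)}
  {W : Submodule ℝ (Fin n → ℝ)} {s : PCGState n} {α : ℝ}

theorem PCGInvariant.init {x0 : Fin n → ℝ} (hx0 : x0 ∈ face J0 Jm Jp) :
    PCGInvariant A b c J0 Jm Jp ⊥ (pcgInit A b c J0 x0) where
  x_mem := hx0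
  r_eq := rfl
  p_eq := rfl
  d_supp i hi := by simp [pcgInit, coordProj, hi]
  W_supp w hw i _ := by rw [(Submodule.mem_bot ℝ).1 hw]; rfl
  p_orth w hw := by rw [(Submodule.mem_bot ℝ).1 hw, zero_dotProduct]
  d_conj w hw := by rw [(Submodule.mem_bot ℝ).1 hw, zero_dotProduct]
  d_add_p_mem := by simp [pcgInit]
  krylov w hw := by
    rw [(Submodule.mem_bot ℝ).1 hw, mulVec_zero]
    convert Submodule.zero_mem _
    exact coordProj_eq_self fun _ _ => rfl

theorem PCGInvariant.p_dotProduct_d (h : PCGInvariant A b c J0 Jm Jp W s) :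
    s.p ⬝ᵥ s.d = -norm2 s.p ^ 2 := by
  have := h.p_orth _ h.d_add_p_mem
  rw [add_dotProduct, ← norm2_sq, dotProduct_comm] at this
  linarith

theorem PCGInvariant.grad_dotProduct_d (h : PCGInvariant A b c J0 Jm Jp W s) :
    (A *ᵥ s.x - b + c) ⬝ᵥ s.d = -norm2 s.p ^ 2 := by
  rw [← h.p_dotProduct_d, h.p_eq, ← h.r_eq, coordProj_dotProduct]
  exact fun i hi => h.d_supp i (by simpa using hi)

theorem PCGInvariant.quadObj_add_smul (hA : A.PosSemidef)
    (h : PCGInvariant A b c J0 Jm Jp W s) (t : ℝ) :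
    quadObj A b c (s.x + t • s.d) =
      quadObj A b c s.x - t * norm2 s.p ^ 2 + (1 / 2) * t ^ 2 * (s.d ⬝ᵥ A *ᵥ s.d) := by
  rw [_root_.quadObj_add_smul hA, h.grad_dotProduct_d]
  ring

theorem alphaCG_nonneg (hA : A.PosSemidef) (s : PCGState n) : 0 ≤ alphaCG A s := by
  unfold alphaCG
  split_ifs
  · exact le_top
  · exact_mod_cast div_nonneg (sq_nonneg _) (hA.zero_le_dotProduct_mulVec _)

theorem alphaTC_nonneg (hx : s.x ∈ face J0 Jm Jp) : 0 ≤ alphaTC J0 Jm Jp s :=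
  le_sSup ⟨0, by simpa using hx, rfl⟩

theorem IsStepLength.nonneg (hA : A.PosSemidef) (hx : s.x ∈ face J0 Jm Jp)
    (hα : IsStepLength A J0 Jm Jp s α) : 0 ≤ α := by
  have : (0 : EReal) ≤ (α : EReal) := hα.2 ▸ le_min (alphaCG_nonneg hA s) (alphaTC_nonneg hx)
  exact_mod_cast this

theorem IsStepLength.mul_le (hA : A.PosSemidef) (hα : IsStepLength A J0 Jm Jp s α) :
    α * (s.d ⬝ᵥ A *ᵥ s.d) ≤ norm2 s.p ^ 2 := by
  by_cases h0 : s.d ⬝ᵥ A *ᵥ s.d = 0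
  · rw [h0, mul_zero]; positivity
  · have h1 : (α : EReal) ≤ alphaCG A s := hα.2 ▸ min_le_left _ _
    rw [alphaCG, if_neg h0, EReal.coe_le_coe_iff] at h1
    exact (le_div_iff₀ ((hA.zero_le_dotProduct_mulVec _).lt_of_ne (Ne.symm h0))).1 h1

/-- As `0 ≤ α ≤ α^cg`, the linear decrease `α‖p‖²` is at least twice the quadratic term. -/
theorem IsStepLength.quadObj_le (hA : A.PosSemidef) (h : PCGInvariant A b c J0 Jm Jp W s)
    (hα : IsStepLength A J0 Jm Jp s α) :
    quadObj A b c (s.x + α • s.d) ≤ quadObj A b c s.x := by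
  rw [h.quadObj_add_smul hA]
  have h1 := mul_le_mul_of_nonneg_left (hα.mul_le hA) (hα.nonneg hA h.x_mem)
  have h2 := mul_nonneg (hα.nonneg hA h.x_mem) (sq_nonneg (norm2 s.p))
  nlinarith

/-- A step which is not cut off has the full CG length. -/
theorem IsStepLength.eq_of_not_lt (hα : IsStepLength A J0 Jm Jp s α)
    (hcut : ¬ (α : EReal) < alphaCG A s) :
    s.d ⬝ᵥ A *ᵥ s.d ≠ 0 ∧ α = norm2 s.p ^ 2 / (s.d ⬝ᵥ A *ᵥ s.d) := by
  have h1 : (α : EReal) = alphaCG A s :=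
    le_antisymm (hα.2 ▸ min_le_left _ _) (not_lt.1 hcut)
  unfold alphaCG at h1
  split_ifs at h1 with h0
  · exact absurd h1 (EReal.coe_ne_top α)
  · exact ⟨h0, by exact_mod_cast h1⟩

/-- `alphaTC` is only a supremum, so feasibility at `α` needs an argument: a sign violated at `α` is
already lost past the crossing point `-x_j / d_j < α`, yet there are feasible steps beyond that
point. -/
theorem add_smul_mem_face (hx : s.x ∈ face J0 Jm Jp) (hd : ∀ i ∈ J0, s.d i = 0) (h0 : 0 ≤ α)
    (hα : (α : EReal) ≤ alphaTC J0 Jm Jp s) : s.x + α • s.d ∈ face J0 Jm Jp := by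
  have key : ∀ γ < α, ∃ β, γ < β ∧ s.x + β • s.d ∈ face J0 Jm Jp := by
    intro γ hγ
    have h1 : (γ : EReal) < alphaTC J0 Jm Jp s := lt_of_lt_of_le (by exact_mod_cast hγ) hα
    obtain ⟨_, ⟨β, hβ, rfl⟩, h2⟩ := lt_sSup_iff.1 h1
    exact ⟨β, by exact_mod_cast h2, hβ⟩
  refine ⟨fun j hj => by simp [hx.1 j hj, hd j hj], fun j hj => ?_, fun j hj => ?_⟩
  · by_contra! hlt
    simp only [Pi.add_apply, Pi.smul_apply, smul_eq_mul] at hlt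
    have hxj := hx.2.1 j hj
    have hdj : 0 < s.d j := by
      by_contra! hle
      linarith [mul_nonpos_of_nonneg_of_nonpos h0 hle]
    obtain ⟨β, hβ, hmem⟩ := key (-s.x j / s.d j) (by rw [div_lt_iff₀ hdj]; linarith)
    have := hmem.2.1 j hj
    simp only [Pi.add_apply, Pi.smul_apply, smul_eq_mul] at this
    rw [div_lt_iff₀ hdj] at hβ
    linarith
  · by_contra! hlt
    simp only [Pi.add_apply, Pi.smul_apply, smul_eq_mul] at hlt
    have hxj := hx.2.2 j hj
    have hdj : s.d j < 0 := by
      by_contra! hle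
      linarith [mul_nonneg h0 hle]
    obtain ⟨β, hβ, hmem⟩ := key (-s.x j / s.d j) (by rw [div_lt_iff_of_neg hdj]; linarith)
    have := hmem.2.2 j hj
    simp only [Pi.add_apply, Pi.smul_apply, smul_eq_mul] at this
    rw [div_lt_iff_of_neg hdj] at hβ
    linarith

theorem IsStepLength.mem_face (hA : A.PosSemidef) (h : PCGInvariant A b c J0 Jm Jp W s)
    (hα : IsStepLength A J0 Jm Jp s α) : s.x + α • s.d ∈ face J0 Jm Jp :=
  add_smul_mem_face h.x_mem h.d_supp (hα.nonneg hA h.x_mem) (hα.2 ▸ min_le_right _ _)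

/-- The largest feasible step makes a further coordinate vanish. -/
theorem exists_apply_eq_zero_of_eq_alphaTC (hx : s.x ∈ face J0 Jm Jp)
    (hd : ∀ i ∈ J0, s.d i = 0) (hm : Disjoint J0 Jm) (hp : Disjoint J0 Jp)
    (hmem : s.x + α • s.d ∈ face J0 Jm Jp) (hα : (α : EReal) = alphaTC J0 Jm Jp s) :
    ∃ j ∉ J0, (s.x + α • s.d) j = 0 := by
  -- Otherwise all sign constraints hold strictly at `α`, hence by continuity at some `t > α`, which
  -- exceeds the supremum.
  by_contra! hne
  have hcont : ∀ j, Filter.Tendsto (fun t : ℝ => (s.x + t • s.d) j) (nhds α)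
      (nhds ((s.x + α • s.d) j)) := fun j => by
    have : Continuous fun t : ℝ => (s.x + t • s.d) j := by
      simp only [Pi.add_apply, Pi.smul_apply, smul_eq_mul]; fun_prop
    exact this.tendsto α
  have h1 : ∀ᶠ t in nhds α, ∀ j ∈ Jm, (s.x + t • s.d) j < 0 :=
    (Finset.eventually_all Jm).2 fun j hj => (hcont j).eventually_lt_const
      ((hmem.2.1 j hj).lt_of_ne (hne j (Finset.disjoint_right.1 hm hj)))
  have h2 : ∀ᶠ t in nhds α, ∀ j ∈ Jp, 0 < (s.x + t • s.d) j :=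
    (Finset.eventually_all Jp).2 fun j hj => (hcont j).eventually_const_lt
      ((hmem.2.2 j hj).lt_of_ne (hne j (Finset.disjoint_right.1 hp hj)).symm)
  obtain ⟨t, ⟨h3, h4⟩, ht⟩ :=
    (((h1.and h2).filter_mono (nhdsWithin_le_nhds (s := Set.Ioi α))).and
      self_mem_nhdsWithin).exists
  have h5 : (t : EReal) ≤ α := hα ▸ le_sSup ⟨t, ⟨fun j hj => by simp [hx.1 j hj, hd j hj],
    fun j hj => (h3 j hj).le, fun j hj => (h4 j hj).le⟩, rfl⟩
  exact absurd (EReal.coe_le_coe_iff.1 h5) (not_le.2 ht)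

theorem PCGInvariant.d_mem (h : PCGInvariant A b c J0 Jm Jp W s) :
    s.d ∈ W ⊔ Submodule.span ℝ {s.p} := by
  have h1 : s.d + s.p ∈ W ⊔ Submodule.span ℝ {s.p} := Submodule.mem_sup_left h.d_add_p_mem
  have h2 : s.p ∈ W ⊔ Submodule.span ℝ {s.p} :=
    Submodule.mem_sup_right (Submodule.mem_span_singleton_self _)
  simpa using Submodule.sub_mem _ h1 h2

/-- Since `d + p ∈ W`, the direction can replace the gradient as the new generator. Properties of
the enlarged space then need checking only on `W` and on `d`. -/
theorem PCGInvariant.exists_eq_add_smul_d (h : PCGInvariant A b c J0 Jm Jp W s)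
    {w : Fin n → ℝ} (hw : w ∈ W ⊔ Submodule.span ℝ {s.p}) :
    ∃ w' ∈ W, ∃ t : ℝ, w = w' + t • s.d := by
  obtain ⟨u, hu, v, hv, rfl⟩ := Submodule.mem_sup.1 hw
  obtain ⟨t, rfl⟩ := Submodule.mem_span_singleton.1 hv
  exact ⟨u + t • (s.d + s.p), W.add_mem hu (W.smul_mem t h.d_add_p_mem), -t, by module⟩

/-- The classical CG induction. The new gradient is orthogonal to `W` by conjugacy of `d` and to `d`
by the choice of `α`. The new direction is conjugate to `W` because `PAW` lies in the enlarged
space, orthogonal to the new gradient, and to `d` by the choice of `β`. -/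
theorem PCGInvariant.next (hA : A.PosSemidef) (h : PCGInvariant A b c J0 Jm Jp W s)
    (hα : IsStepLength A J0 Jm Jp s α) (hcut : ¬ (α : EReal) < alphaCG A s) :
    PCGInvariant A b c J0 Jm Jp (W ⊔ Submodule.span ℝ {s.p}) (pcgNext A J0 s α) := by
  obtain ⟨hd0, hαeq⟩ := hα.eq_of_not_lt hcut
  have hp0 : norm2 s.p ^ 2 ≠ 0 := pow_ne_zero 2 (norm2_pos hα.1).ne'
  have hα0 : α ≠ 0 := hαeq ▸ div_ne_zero hp0 hd0
  have hαd : α * (s.d ⬝ᵥ A *ᵥ s.d) = norm2 s.p ^ 2 := by rw [hαeq, div_mul_cancel₀ _ hd0]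
  set W' := W ⊔ Submodule.span ℝ {s.p} with hW'
  set p' := (pcgNext A J0 s α).p with hp'
  set β := norm2 p' ^ 2 / norm2 s.p ^ 2 with hβ
  have hd' : (pcgNext A J0 s α).d = -p' + β • s.d := rfl
  have hpstep : p' = s.p + α • coordProj J0ᶜ (A *ᵥ s.d) := by
    rw [h.p_eq, ← coordProj_smul, ← coordProj_add]; rfl
  have hp'supp : ∀ i ∈ J0, p' i = 0 := fun i hi =>
    coordProj_apply_of_notMem _ (by simpa using hi)
  have hPA : ∀ u w : Fin n → ℝ, (∀ i ∈ J0, u i = 0) →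
      u ⬝ᵥ coordProj J0ᶜ (A *ᵥ w) = u ⬝ᵥ A *ᵥ w := fun u w hu => by
    rw [dotProduct_comm, coordProj_dotProduct _ (fun i hi => hu i (by simpa using hi)),
      dotProduct_comm]
  have hPAd : coordProj J0ᶜ (A *ᵥ s.d) = α⁻¹ • (p' - s.p) := by
    rw [hpstep, add_sub_cancel_left, inv_smul_smul₀ hα0]
  have hWsupp : ∀ w ∈ W', ∀ i ∈ J0, w i = 0 := by
    intro w hw i hi
    obtain ⟨u, hu, t, rfl⟩ := h.exists_eq_add_smul_d hw
    simp [h.W_supp u hu i hi, h.d_supp i hi]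
  have horth : ∀ w ∈ W', w ⬝ᵥ p' = 0 := by
    intro w hw
    obtain ⟨u, hu, t, rfl⟩ := h.exists_eq_add_smul_d hw
    have e1 := h.p_dotProduct_d
    rw [dotProduct_comm] at e1
    rw [hpstep, dotProduct_add, dotProduct_smul, hPA _ _ (hWsupp _ hw), add_dotProduct,
      add_dotProduct, h.p_orth u hu, h.d_conj u hu, smul_dotProduct, smul_dotProduct, e1]
    simp only [smul_eq_mul]
    linear_combination t * hαd
  have hpW' : s.p ∈ W' := Submodule.mem_sup_right (Submodule.mem_span_singleton_self _)
  refine ⟨hα.mem_face hA h, ?_, rfl, ?_, hWsupp, horth, ?_, ?_, ?_⟩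
  · simp only [pcgNext, h.r_eq, mulVec_add, mulVec_smul]
    abel
  · intro i hi
    rw [hd']
    simp [hp'supp i hi, h.d_supp i hi]
  · intro w hw
    obtain ⟨u, hu, t, rfl⟩ := h.exists_eq_add_smul_d hw
    have e1 : u ⬝ᵥ A *ᵥ p' = 0 := by
      rw [hA.dotProduct_mulVec_comm, ← hPA _ _ hp'supp, dotProduct_comm]
      exact horth _ (h.krylov u hu)
    have e2 : s.d ⬝ᵥ A *ᵥ p' = α⁻¹ * norm2 p' ^ 2 := by
      rw [hA.dotProduct_mulVec_comm, ← hPA _ _ hp'supp, hPAd, dotProduct_smul, dotProduct_sub,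
        ← norm2_sq, dotProduct_comm p' s.p, horth _ hpW', sub_zero, smul_eq_mul]
    have e3 : β * (s.d ⬝ᵥ A *ᵥ s.d) = α⁻¹ * norm2 p' ^ 2 := by
      rw [hβ, ← hαd]; field_simp
    rw [hd', mulVec_add, mulVec_neg, mulVec_smul, dotProduct_add, dotProduct_neg,
      dotProduct_smul, add_dotProduct, add_dotProduct, h.d_conj u hu, e1, smul_dotProduct,
      smul_dotProduct, e2]
    simp only [smul_eq_mul]
    linear_combination t * e3
  · rw [hd', neg_add_eq_sub, sub_add_cancel]
    exact Submodule.smul_mem _ _ h.d_mem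
  · intro w hw
    obtain ⟨u, hu, t, rfl⟩ := h.exists_eq_add_smul_d hw
    rw [mulVec_add, mulVec_smul, coordProj_add, coordProj_smul, hPAd]
    refine Submodule.add_mem _ (Submodule.mem_sup_left (h.krylov u hu)) ?_
    exact Submodule.smul_mem _ _ (Submodule.smul_mem _ _ (Submodule.sub_mem _
      (Submodule.mem_sup_right (Submodule.mem_span_singleton_self _))
      (Submodule.mem_sup_left hpW')))

theorem TPCG1Loop.spec {δ : ℝ} {y : Fin n → ℝ} (hA : A.PosSemidef) (hm : Disjoint J0 Jm)
    (hp : Disjoint J0 Jp) (hy : TPCG1Loop A J0 Jm Jp δ s y)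
    (h : PCGInvariant A b c J0 Jm Jp W s) :
    y ∈ face J0 Jm Jp ∧ quadObj A b c y ≤ quadObj A b c s.x ∧
      ((∃ j ∉ J0, y j = 0) ∨ ‖coordProj J0ᶜ (A *ᵥ y - b + c)‖ ≤ δ) := by
  induction hy generalizing W with
  | truncate s α hα hcut =>
    refine ⟨hα.mem_face hA h, hα.quadObj_le hA h, Or.inl ?_⟩
    refine exists_apply_eq_zero_of_eq_alphaTC h.x_mem h.d_supp hm hp (hα.mem_face hA h) ?_
    rcases min_choice (alphaCG A s) (alphaTC J0 Jm Jp s) with h1 | h1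
    · exact absurd (hα.2.trans h1) hcut.ne
    · exact hα.2.trans h1
  | finish s α hα hcut hres =>
    have h' := h.next hA hα hcut
    refine ⟨h'.x_mem, hα.quadObj_le hA h, Or.inr ?_⟩
    rw [← h'.r_eq, ← h'.p_eq]
    exact hres
  | next s α y hα hcut hres hrest ih =>
    obtain ⟨h1, h2, h3⟩ := ih (h.next hA hα hcut)
    exact ⟨h1, h2.trans (hα.quadObj_le hA h), h3⟩

/-- If both step lengths were infinite, the quadratic would decrease linearly along arbitrarily long
feasible steps. -/
theorem PCGInvariant.exists_isStepLength (hA : A.PosSemidef)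
    (h : PCGInvariant A b c J0 Jm Jp W s) (hp : s.p ≠ 0)
    (hbdd : BddBelow (quadObj A b c '' face J0 Jm Jp)) :
    ∃ α, IsStepLength A J0 Jm Jp s α := by
  have hmin : min (alphaCG A s) (alphaTC J0 Jm Jp s) ≠ ⊤ := by
    intro htop
    obtain ⟨h1, h2⟩ := min_eq_top.1 htop
    have hd : s.d ⬝ᵥ A *ᵥ s.d = 0 := by
      by_contra hd
      rw [alphaCG, if_neg hd] at h1
      exact EReal.coe_ne_top _ h1
    obtain ⟨m, hm⟩ := hbdd
    have hlt : (((quadObj A b c s.x - m) / norm2 s.p ^ 2 : ℝ) : EReal) < alphaTC J0 Jm Jp s :=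
      h2 ▸ EReal.coe_lt_top _
    obtain ⟨_, ⟨t, ht, rfl⟩, hlt⟩ := lt_sSup_iff.1 hlt
    have h3 := hm ⟨_, ht, rfl⟩
    rw [h.quadObj_add_smul hA, hd] at h3
    rw [EReal.coe_lt_coe_iff, div_lt_iff₀ (pow_pos (norm2_pos hp) 2)] at hlt
    linarith
  have h0 := le_min (alphaCG_nonneg hA s) (alphaTC_nonneg h.x_mem)
  exact ⟨_, hp, EReal.coe_toReal hmin (ne_bot_of_le_ne_bot EReal.zero_ne_bot h0)⟩

/-- A nonzero `p` orthogonal to `W` strictly enlarges `W`, which can happen only finitely often in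
finite dimension. -/
theorem PCGInvariant.exists_TPCG1Loop {δ : ℝ} (hδ : 0 ≤ δ) (hA : A.PosSemidef)
    (h : PCGInvariant A b c J0 Jm Jp W s) (hp : s.p ≠ 0)
    (hbdd : BddBelow (quadObj A b c '' face J0 Jm Jp)) :
    ∃ y, TPCG1Loop A J0 Jm Jp δ s y := by
  induction W using WellFoundedGT.induction generalizing s with
  | _ W ih =>
    obtain ⟨α, hα⟩ := h.exists_isStepLength hA hp hbdd
    by_cases hcut : (α : EReal) < alphaCG A s
    · exact ⟨_, .truncate s α hα hcut⟩
    by_cases hres : ‖(pcgNext A J0 s α).p‖ ≤ δ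
    · exact ⟨_, .finish s α hα hcut hres⟩
    have hlt : W < W ⊔ Submodule.span ℝ {s.p} := by
      refine lt_of_le_of_ne le_sup_left fun heq => hp ?_
      have hmem : s.p ∈ W := by
        rw [heq]
        exact Submodule.mem_sup_right (Submodule.mem_span_singleton_self _)
      have := h.p_orth _ hmem
      rw [← norm2_sq] at this
      exact norm2_eq_zero.1 (pow_eq_zero_iff two_ne_zero |>.1 this)
    obtain ⟨y, hy⟩ := ih _ hlt (h.next hA hα hcut) fun h0 => hres (by rw [h0, norm_zero]; exact hδ)
    exact ⟨y, .next s α y hα hcut hres hy⟩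

end

/-! ### One conjugate gradient iteration of the method -/

section

variable {n : ℕ} {A : Matrix (Fin n) (Fin n) ℝ} {b : Fin n → ℝ} {τ : ℝ} {x y : Fin n → ℝ}

theorem cVec_apply_of_ne {i : Fin n} (h : x i ≠ 0) :
    cVec A b τ x i = τ * Real.sign (x i) := by
  rcases lt_or_gt_of_ne h with h' | h'
  · simp [cVec, idxPos, idxNeg, idxZeroPos, h, h', h'.not_gt, Real.sign_of_neg h']
  · simp [cVec, idxPos, h', Real.sign_of_pos h']

theorem self_mem_face (x : Fin n → ℝ) : x ∈ face (idxZero x) (idxNeg x) (idxPos x) := by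
  refine ⟨fun j hj => mem_idxZero.1 hj, fun j hj => ?_, fun j hj => ?_⟩
  · simp only [idxNeg, Finset.mem_filter] at hj; exact hj.2.le
  · simp only [idxPos, Finset.mem_filter] at hj; exact hj.2.le

theorem disjoint_idxZero_idxNeg (x : Fin n → ℝ) : Disjoint (idxZero x) (idxNeg x) := by
  refine Finset.disjoint_left.2 fun i h0 h1 => ?_
  simp only [idxNeg, Finset.mem_filter] at h1
  exact h1.2.ne (mem_idxZero.1 h0)

theorem disjoint_idxZero_idxPos (x : Fin n → ℝ) : Disjoint (idxZero x) (idxPos x) := by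
  refine Finset.disjoint_left.2 fun i h0 h1 => ?_
  simp only [idxPos, Finset.mem_filter] at h1
  exact h1.2.ne' (mem_idxZero.1 h0)

theorem sign_eq_of_mem_face (hy : y ∈ face (idxZero x) (idxNeg x) (idxPos x)) {i : Fin n}
    (hi : y i ≠ 0) : x i ≠ 0 ∧ Real.sign (y i) = Real.sign (x i) := by
  rcases lt_trichotomy (x i) 0 with h | h | h
  · have := hy.2.1 i (by simp [idxNeg, h])
    rw [Real.sign_of_neg h, Real.sign_of_neg (this.lt_of_ne hi)]
    exact ⟨h.ne, rfl⟩
  · exact absurd (hy.1 i (mem_idxZero.2 h)) hi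
  · have := hy.2.2 i (by simp [idxPos, h])
    rw [Real.sign_of_pos h, Real.sign_of_pos (this.lt_of_ne hi.symm)]
    exact ⟨h.ne', rfl⟩

theorem objF_eq_quadObj_of_mem_face (hy : y ∈ face (idxZero x) (idxNeg x) (idxPos x)) :
    objF A b τ y = quadObj A b (cVec A b τ x) y := by
  refine objF_eq_quadObj A b τ fun i => ?_
  by_cases hi : y i = 0
  · simp [hi]
  · obtain ⟨h1, h2⟩ := sign_eq_of_mem_face hy hi
    rw [cVec_apply_of_ne h1, ← h2, mul_assoc, Real.sign_mul_self_eq_abs]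

theorem minSubgrad_apply_of_mem_face (hy : y ∈ face (idxZero x) (idxNeg x) (idxPos x))
    {i : Fin n} (hi : y i ≠ 0) :
    minSubgrad A b τ y i = coordProj (idxZero x)ᶜ (A *ᵥ y - b + cVec A b τ x) i := by
  obtain ⟨h1, h2⟩ := sign_eq_of_mem_face hy hi
  rw [minSubgrad_apply_of_ne A b τ hi, coordProj_apply_of_mem _ (by simpa [mem_idxZero] using h1),
    Pi.add_apply, cVec_apply_of_ne h1, h2]

theorem coordProj_minSubgrad_eq (A : Matrix (Fin n) (Fin n) ℝ) (b : Fin n → ℝ) (τ : ℝ)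
    (x : Fin n → ℝ) : coordProj (idxZero x)ᶜ (minSubgrad A b τ x) =
      coordProj (idxZero x)ᶜ (A *ᵥ x - b + cVec A b τ x) := by
  rw [← coordProj_coordProj _ (A *ᵥ x - b + cVec A b τ x)]
  refine coordProj_congr fun i hi => minSubgrad_apply_of_mem_face (self_mem_face x) ?_
  simpa [mem_idxZero] using hi

theorem TPCG1Returns.spec {δ : ℝ} (hA : A.PosSemidef) (hδ : 0 ≤ δ)
    (hy : TPCG1Returns A b (cVec A b τ x) (idxZero x) (idxNeg x) (idxPos x) x δ y) :
    objF A b τ y ≤ objF A b τ x ∧ idxZero x ⊆ idxZero y ∧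
      (idxZero x ⊂ idxZero y ∨ ‖coordProj (idxZero y)ᶜ (minSubgrad A b τ y)‖ ≤ δ) := by
  obtain ⟨h1, h2, h3⟩ := TPCG1Loop.spec hA (disjoint_idxZero_idxNeg x)
    (disjoint_idxZero_idxPos x) hy (PCGInvariant.init (self_mem_face x))
  have hsub : idxZero x ⊆ idxZero y := fun i hi => mem_idxZero.2 (h1.1 i hi)
  refine ⟨?_, hsub, h3.imp ?_ fun h3 => ?_⟩
  · rw [objF_eq_quadObj_of_mem_face h1, objF_eq_quadObj_of_mem_face (self_mem_face x)]
    exact h2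
  · rintro ⟨j, hj, hj0⟩
    exact Finset.ssubset_iff_subset_ne.2 ⟨hsub, fun h => hj (h ▸ mem_idxZero.2 hj0)⟩
  · refine (pi_norm_le_iff_of_nonneg hδ).2 fun i => ?_
    by_cases hi : y i = 0
    · rw [coordProj_apply_of_notMem _ (by simpa [mem_idxZero] using hi), norm_zero]
      exact hδ
    · rw [coordProj_apply_of_mem _ (by simpa [mem_idxZero] using hi),
        minSubgrad_apply_of_mem_face h1 hi]
      exact (norm_le_pi_norm _ i).trans h3

theorem eq_coordProj_add_coordProj_compl (S : Finset (Fin n)) (v : Fin n → ℝ) :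
    v = coordProj S v + coordProj Sᶜ v := by
  funext i; by_cases hi : i ∈ S <;> simp [coordProj, hi]

/-- If the free part vanished, the failed test would force `v = 0`. This makes the first CG gradient
nonzero and shows that `x` has a nonzero coordinate. -/
theorem coordProj_compl_ne_zero {η ε : ℝ} (hε : 0 ≤ ε) (htest : ¬ ReleaseTest A b τ η x)
    (hlarge : ¬ ‖minSubgrad A b τ x‖ ≤ ε) :
    coordProj (idxZero x)ᶜ (minSubgrad A b τ x) ≠ 0 := by
  intro h0
  rw [ReleaseTest, h0, norm2_eq_zero.2 rfl, mul_zero, gt_iff_lt, not_lt] at htest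
  have h1 := norm2_eq_zero.1 (le_antisymm htest (norm2_nonneg _))
  refine hlarge ?_
  rw [eq_coordProj_add_coordProj_compl (idxZero x) (minSubgrad A b τ x), h0, h1, add_zero,
    norm_zero]
  exact hε

theorem exists_TPCG1Returns {η ε δ : ℝ} (hA : A.PosSemidef) (hopt : ∃ x, IsOptimal A b τ x)
    (hε : 0 ≤ ε) (hδ : 0 ≤ δ) (htest : ¬ ReleaseTest A b τ η x)
    (hlarge : ¬ ‖minSubgrad A b τ x‖ ≤ ε) :
    ∃ y, TPCG1Returns A b (cVec A b τ x) (idxZero x) (idxNeg x) (idxPos x) x δ y := by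
  refine (PCGInvariant.init (self_mem_face x)).exists_TPCG1Loop hδ hA ?_ ?_
  · have := coordProj_compl_ne_zero hε htest hlarge
    rwa [coordProj_minSubgrad_eq] at this
  · rw [← Set.EqOn.image_eq fun y hy => objF_eq_quadObj_of_mem_face hy]
    exact bddBelow_objF_image hopt _

/-- After CG has converged on a face, the method stops or the release test holds. -/
theorem norm_minSubgrad_le_of_not_releaseTest {η ε : ℝ} (hε : 0 ≤ ε)
    (htest : ¬ ReleaseTest A b τ η x)
    (h : ‖coordProj (idxZero x)ᶜ (minSubgrad A b τ x)‖ ≤ ε / max (√(n * η)) 1) :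
    ‖minSubgrad A b τ x‖ ≤ ε := by
  have hmax : 0 < max (√(n * η)) 1 := lt_max_of_lt_right one_pos
  have hδ := (le_div_iff₀ hmax).1 h
  set v := minSubgrad A b τ x
  set N := ‖coordProj (idxZero x)ᶜ v‖
  have hN : 0 ≤ N := norm_nonneg _
  refine (pi_norm_le_iff_of_nonneg hε).2 fun i => ?_
  by_cases hi : x i = 0
  -- The failed test costs `√η` and passing from the Euclidean to the max-norm costs `√n`, which the
  -- tolerance `ε / max(√(nη), 1)` absorbs.
  · calc ‖v i‖ = |coordProj (idxZero x) v i| := by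
          rw [coordProj_apply_of_mem _ (mem_idxZero.2 hi), Real.norm_eq_abs]
      _ ≤ norm2 (coordProj (idxZero x) v) := abs_apply_le_norm2 _ i
      _ ≤ √η * norm2 (coordProj (idxZero x)ᶜ v) := not_lt.1 htest
      _ ≤ √η * (√n * N) :=
          mul_le_mul_of_nonneg_left (norm2_le_sqrt_mul_norm _) (Real.sqrt_nonneg _)
      _ = N * √(n * η) := by rw [Real.sqrt_mul (Nat.cast_nonneg n)]; ring
      _ ≤ N * max (√(n * η)) 1 := mul_le_mul_of_nonneg_left (le_max_left _ _) hN
      _ ≤ ε := hδ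
  · calc ‖v i‖ = ‖coordProj (idxZero x)ᶜ v i‖ := by
          rw [coordProj_apply_of_mem _ (by simpa [mem_idxZero] using hi)]
      _ ≤ N := norm_le_pi_norm _ i
      _ ≤ N * max (√(n * η)) 1 := le_mul_of_one_le_right hN (le_max_right _ _)
      _ ≤ ε := hδ

/-! ### The line search -/

/-- Along `-v^p` each released coordinate immediately takes, and keeps, the sign for which `v` was
computed, so one quadratic represents `F` on the whole ray. -/
theorem objF_sub_smul_projSubgrad (hA : A.PosSemidef) (hτ : 0 ≤ τ) {t : ℝ} (ht : 0 ≤ t) :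
    objF A b τ (x - t • projSubgrad A b τ x) =
      objF A b τ x - t * norm2 (projSubgrad A b τ x) ^ 2 +
        (1 / 2) * t ^ 2 * (projSubgrad A b τ x ⬝ᵥ A *ᵥ projSubgrad A b τ x) := by
  set u := projSubgrad A b τ x with hu
  set c := minSubgrad A b τ x - (A *ᵥ x - b) with hc
  have key : ∀ s : ℝ, 0 ≤ s → ∀ i, c i * (x - s • u) i = τ * |(x - s • u) i| := by
    intro s hs i
    by_cases hi : x i = 0
    · have hui : u i = minSubgrad A b τ x i := coordProj_apply_of_mem _ (mem_idxZero.2 hi)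
      have hv : minSubgrad A b τ x i =
          min ((A *ᵥ x - b) i + τ) (max 0 ((A *ᵥ x - b) i - τ)) := if_pos hi
      simp only [hc, Pi.sub_apply, Pi.smul_apply, smul_eq_mul, hi, zero_sub, abs_neg, abs_mul,
        abs_of_nonneg hs, hui] at hv ⊢
      generalize (A *ᵥ x) i - b i = g at hv ⊢
      generalize minSubgrad A b τ x i = w at hv ⊢
      rcases lt_trichotomy w 0 with h | h | h
      · have : w = g + τ := by
          rcases min_choice (g + τ) (max 0 (g - τ)) with h' | h'
          · rw [hv, h']
          · have := le_max_left 0 (g - τ)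
            linarith
        rw [abs_of_neg h, this]
        ring
      · simp [h]
      · have h1 : w ≤ max 0 (g - τ) := hv ▸ min_le_right _ _
        have h2 : 0 < g - τ := by
          by_contra! h2
          rw [max_eq_left h2] at h1
          linarith
        rw [max_eq_right h2.le, min_eq_right (by linarith)] at hv
        rw [abs_of_pos h, hv]
        ring
    · have hui : u i = 0 := coordProj_apply_of_notMem _ (by rwa [mem_idxZero])
      rw [hc, Pi.sub_apply, minSubgrad_apply_of_ne A b τ hi, add_sub_cancel_left, Pi.sub_apply,
        Pi.smul_apply, hui, smul_zero, sub_zero, mul_assoc, Real.sign_mul_self_eq_abs]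
  have h0 := objF_eq_quadObj A b τ (key 0 le_rfl)
  rw [zero_smul, sub_zero] at h0
  have hgrad : (A *ᵥ x - b + c) ⬝ᵥ u = norm2 u ^ 2 := by
    rw [hc, add_sub_cancel, norm2_sq, hu, projSubgrad, coordProj_dotProduct]
    exact fun i hi => coordProj_apply_of_notMem _ hi
  rw [objF_eq_quadObj A b τ (key t ht), h0, sub_eq_add_neg x, ← neg_smul,
    quadObj_add_smul hA, hgrad]
  ring

theorem projSubgrad_curvature_pos (hA : A.PosSemidef) (hτ : 0 ≤ τ)
    (hopt : ∃ x, IsOptimal A b τ x) (hu : projSubgrad A b τ x ≠ 0) :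
    0 < projSubgrad A b τ x ⬝ᵥ A *ᵥ projSubgrad A b τ x := by
  refine (hA.zero_le_dotProduct_mulVec _).lt_of_ne fun h0 => ?_
  obtain ⟨z, hz⟩ := hopt
  -- With zero curvature `F` is linear on the ray; the next `t` takes it one below its minimum.
  have hpos := pow_pos (norm2_pos hu) 2
  set t := (objF A b τ x - objF A b τ z + 1) / norm2 (projSubgrad A b τ x) ^ 2 with ht
  have ht0 : 0 ≤ t := div_nonneg (by linarith [hz x]) hpos.le
  have h1 := objF_sub_smul_projSubgrad (b := b) (x := x) hA hτ ht0
  rw [← h0, ht, div_mul_cancel₀ _ hpos.ne', ← ht] at h1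
  linarith [hz (x - t • projSubgrad A b τ x)]

/-- The exact minimum on the ray gains `‖u‖⁴ / (2uᵀAu)`, where `uᵀAu ≤ ‖A‖‖u‖²`. -/
theorem lineSearch_decrease (hA : A.PosSemidef) (hτ : 0 ≤ τ)
    (hopt : ∃ x, IsOptimal A b τ x) (hu : projSubgrad A b τ x ≠ 0) :
    norm2 (projSubgrad A b τ x) ^ 2 ≤ 2 * opNorm A * (objF A b τ x -
      objF A b τ (x - (norm2 (projSubgrad A b τ x) ^ 2 /
        (projSubgrad A b τ x ⬝ᵥ A *ᵥ projSubgrad A b τ x)) • projSubgrad A b τ x)) := by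
  have hq := projSubgrad_curvature_pos hA hτ hopt hu
  have hpos := pow_pos (norm2_pos hu) 2
  have h1 := objF_sub_smul_projSubgrad (b := b) (x := x) hA hτ (div_nonneg hpos.le hq.le)
  have h2 := dotProduct_mulVec_le_opNorm A (projSubgrad A b τ x)
  rw [h1]
  set u := projSubgrad A b τ x
  set q := u ⬝ᵥ A *ᵥ u
  set N := norm2 u ^ 2
  have h3 : 2 * opNorm A * (objF A b τ x - (objF A b τ x - N / q * N +
      1 / 2 * (N / q) ^ 2 * q)) = opNorm A * N * N / q := by
    field_simp
    ring
  rw [h3, le_div_iff₀ hq, mul_comm]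
  exact mul_le_mul_of_nonneg_right h2 hpos.le

theorem ReleaseTest.projSubgrad_ne_zero {η : ℝ} (h : ReleaseTest A b τ η x) :
    projSubgrad A b τ x ≠ 0 := by
  intro h0
  have h1 : norm2 (coordProj (idxZero x) (minSubgrad A b τ x)) = 0 := norm2_eq_zero.2 h0
  rw [ReleaseTest, h1] at h
  exact absurd h (not_lt.2 (mul_nonneg (Real.sqrt_nonneg _) (norm2_nonneg _)))

/-- Keeps `∅` out of `𝒞`; hence `2 ^ n - 1` rather than `2 ^ n`. -/
theorem ReleaseTest.idxZero_nonempty {η : ℝ} (h : ReleaseTest A b τ η x) :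
    (idxZero x).Nonempty := by
  by_contra hne
  refine h.projSubgrad_ne_zero ?_
  rw [projSubgrad, Finset.not_nonempty_iff_eq_empty.1 hne]
  exact funext fun i => coordProj_apply_of_notMem _ (Finset.notMem_empty i)

/-- If `η` is an error bound constant, then the line search leaves the face for good. -/
theorem objF_lineSearch_lt {x0 : Fin n → ℝ} {ηs η : ℝ} (hA : A.PosSemidef) (hτ : 0 ≤ τ)
    (hopt : ∃ x, IsOptimal A b τ x) (hηs : ErrorBound A b τ x0 ηs)
    (hη0 : 0 ≤ η) (hη : ηs ≤ η) (hx : objF A b τ x ≤ objF A b τ x0) (htest : ReleaseTest A b τ η x)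
    (hy : ∀ i ∈ idxZero x, y i = 0) :
    objF A b τ (x - (norm2 (projSubgrad A b τ x) ^ 2 /
        (projSubgrad A b τ x ⬝ᵥ A *ᵥ projSubgrad A b τ x)) • projSubgrad A b τ x) <
      objF A b τ y := by
  refine lt_of_lt_of_le ?_ (faceMin_le hopt hy)
  have h1 := lineSearch_decrease hA hτ hopt htest.projSubgrad_ne_zero
  have h2 := hηs x hx
  have h3 := pow_lt_pow_left₀ htest
    (mul_nonneg (Real.sqrt_nonneg _) (norm2_nonneg _)) two_ne_zero
  rw [mul_pow, Real.sq_sqrt hη0] at h3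
  have h4 := mul_le_mul_of_nonneg_right hη
    (sq_nonneg (norm2 (coordProj (idxZero x)ᶜ (minSubgrad A b τ x))))
  have h5 : norm2 (coordProj (idxZero x) (minSubgrad A b τ x)) = norm2 (projSubgrad A b τ x) :=
    rfl
  rw [h5] at h3
  -- `2‖A‖(F(x) - F*_x) ≤ η‖v_free‖² < ‖v^p‖² ≤ 2‖A‖ ·` (line search decrease). Cancelling from a
  -- strict inequality only needs `‖A‖ ≥ 0`.
  have h6 := h2.trans_lt (h4.trans_lt (h3.trans_le h1))
  have h7 := lt_of_mul_lt_mul_left h6 (mul_nonneg zero_le_two (opNorm_nonneg A))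
  linarith

end

/-! ### Counting iterations -/

/-- A bound for the number of iterations between two increases of `η̂`. -/
def phaseBound (n : ℕ) : ℕ := 1 + (n + 2) * (2 ^ n - 1)

/-- The invariant of the loop of GCG method 3 after `k` iterations, `j` of which increased `η̂`. -/
structure GCG3Invariant {n : ℕ} (A : Matrix (Fin n) (Fin n) ℝ) (b : Fin n → ℝ) (τ : ℝ)
    (x0 : Fin n → ℝ) (η0 ρ ε ηs : ℝ) (k j : ℕ) (s : GCG3State n) : Prop where
  eta_eq : s.eta = η0 * ρ ^ j
  eta_lt : j = 0 ∨ s.eta < ρ * ηs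
  objF_le : objF A b τ s.x ≤ objF A b τ x0
  nonempty_of_mem : ∀ S ∈ s.C, S.Nonempty
  objF_lt : ηs ≤ s.eta → ∀ S ∈ s.C, ∀ y : Fin n → ℝ, (∀ i ∈ S, y i = 0) →
    objF A b τ s.x < objF A b τ y
  count : k ≤ j * phaseBound n + s.C.card * (n + 1) + n
  -- When another CG call is due, every earlier one of the current streak added a zero coordinate.
  count_of_not_releaseTest : ¬ ReleaseTest A b τ s.eta s.x → ¬ ‖minSubgrad A b τ s.x‖ ≤ ε →
    k ≤ j * phaseBound n + s.C.card * (n + 1) + (idxZero s.x).card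

section

variable {n : ℕ} {A : Matrix (Fin n) (Fin n) ℝ} {b : Fin n → ℝ} {τ : ℝ} {x0 : Fin n → ℝ}
  {η0 ρ ε ηs : ℝ} {k j : ℕ} {s s' : GCG3State n}

theorem GCG3Invariant.init :
    GCG3Invariant A b τ x0 η0 ρ ε ηs 0 0 ⟨x0, η0, ∅⟩ where
  eta_eq := by simp
  eta_lt := Or.inl rfl
  objF_le := le_rfl
  nonempty_of_mem := by simp
  objF_lt := by simp
  count := Nat.zero_le _
  count_of_not_releaseTest _ _ := Nat.zero_le _

theorem card_le_of_forall_nonempty {C : Finset (Finset (Fin n))} (h : ∀ S ∈ C, S.Nonempty) :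
    C.card ≤ 2 ^ n - 1 := by
  have hsub : C ⊆ Finset.univ.erase ∅ := fun S hS =>
    Finset.mem_erase.2 ⟨(h S hS).ne_empty, Finset.mem_univ S⟩
  simpa [Finset.card_erase_of_mem] using Finset.card_le_card hsub

/-- Each line search is charged with itself and `n` CG calls; `n` further CG calls and one pass that
raises `η̂` or stops complete the phase. The inequality `n ≤ 2 ^ n - 1` gives the closed form. -/
theorem mul_card_add_le_phaseBound {m : ℕ} (hm : m ≤ 2 ^ n - 1) :
    m * (n + 1) + n + 1 ≤ phaseBound n := by
  have h1 : n < 2 ^ n := Nat.lt_two_pow_self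
  have h2 := Nat.mul_le_mul_right (n + 1) hm
  have h3 : (n + 2) * (2 ^ n - 1) = (2 ^ n - 1) * (n + 1) + (2 ^ n - 1) := by ring
  unfold phaseBound
  omega

theorem GCG3Invariant.succ_le (h : GCG3Invariant A b τ x0 η0 ρ ε ηs k j s) :
    k + 1 ≤ (j + 1) * phaseBound n := by
  have h1 := mul_card_add_le_phaseBound (card_le_of_forall_nonempty h.nonempty_of_mem)
  have h2 := h.count
  rw [add_one_mul]
  omega

theorem GCG3Invariant.eta_pos (h : GCG3Invariant A b τ x0 η0 ρ ε ηs k j s) (hη0 : 0 < η0)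
    (hρ : 1 < ρ) : 0 < s.eta := by
  rw [h.eta_eq]; positivity

theorem GCG3Invariant.step (hA : A.PosSemidef) (hτ : 0 ≤ τ) (hopt : ∃ x, IsOptimal A b τ x)
    (hη0 : 0 < η0) (hρ : 1 < ρ) (hε : 0 ≤ ε) (hηs : ErrorBound A b τ x0 ηs)
    (h : GCG3Invariant A b τ x0 η0 ρ ε ηs k j s) (hlarge : ¬ ‖minSubgrad A b τ s.x‖ ≤ ε)
    (hstep : GCG3Step A b τ ρ ε s s') :
    ∃ j', GCG3Invariant A b τ x0 η0 ρ ε ηs (k + 1) j' s' := by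
  have hη := h.eta_pos hη0 hρ
  cases hstep with
  | raise htest hC =>
    have hk := h.succ_le
    refine ⟨j + 1, ?_, Or.inr ?_, h.objF_le, by simp, by simp, ?_, fun _ _ => ?_⟩
    · simp only [h.eta_eq]; ring
    · obtain ⟨S, hS, hSx⟩ := hC
      -- If `η* ≤ η̂`, the current iterate could not vanish on a stored set `S`, as `F` would be
      -- strictly below its own value.
      refine mul_lt_mul_of_pos_left (not_le.1 fun hle => ?_) (by linarith)
      exact lt_irrefl _ (h.objF_lt hle S hS s.x fun i hi => mem_idxZero.1 (hSx hi))
    · exact le_add_right (le_add_right hk)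
    · exact le_add_right (le_add_right hk)
  | lineSearch htest hC hdenom =>
    set u := projSubgrad A b τ s.x
    have hdec : objF A b τ (s.x - (norm2 u ^ 2 / (u ⬝ᵥ A *ᵥ u)) • u) ≤ objF A b τ s.x := by
      have h1 := lineSearch_decrease hA hτ hopt htest.projSubgrad_ne_zero
      have h2 := (pow_pos (norm2_pos htest.projSubgrad_ne_zero) 2).trans_le h1
      have h3 := pos_of_mul_pos_right h2 (mul_nonneg zero_le_two (opNorm_nonneg A))
      linarith
    have hcard : (insert (idxZero s.x) s.C).card = s.C.card + 1 :=
      Finset.card_insert_of_notMem fun hmem => hC ⟨_, hmem, subset_rfl⟩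
    have hk : k + 1 ≤ j * phaseBound n + (insert (idxZero s.x) s.C).card * (n + 1) := by
      have := h.count
      rw [hcard, add_one_mul]
      omega
    refine ⟨j, h.eta_eq, h.eta_lt, hdec.trans h.objF_le, ?_, ?_, ?_, fun _ _ => ?_⟩
    · exact (Finset.forall_mem_insert _ _ _).2 ⟨htest.idxZero_nonempty, h.nonempty_of_mem⟩
    · exact fun hle => (Finset.forall_mem_insert _ _ _).2
        ⟨fun y hy => objF_lineSearch_lt hA hτ hopt hηs hη.le hle h.objF_le htest hy,
          fun S hS y hy => hdec.trans_lt (h.objF_lt hle S hS y hy)⟩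
    · exact le_add_right hk
    · exact le_add_right hk
  | cg y htest hy =>
    obtain ⟨h1, h2, h3⟩ := hy.spec hA (by positivity)
    have hk := h.count_of_not_releaseTest htest hlarge
    -- Strictness pays for this CG call even when it adds no zero coordinate.
    have hlt : (idxZero s.x).card < n := by
      have hne := coordProj_compl_ne_zero hε htest hlarge
      obtain ⟨i, hi⟩ := Function.ne_iff.1 hne
      have hi' : i ∉ idxZero s.x := fun hmem =>
        hi (coordProj_apply_of_notMem _ (by simpa using hmem))
      simpa using Finset.card_lt_univ_of_notMem hi'
    refine ⟨j, h.eta_eq, h.eta_lt, h1.trans h.objF_le, h.nonempty_of_mem,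
      fun hle S hS z hz => h1.trans_lt (h.objF_lt hle S hS z hz), ?_, fun htest' hlarge' => ?_⟩
    · simp only
      omega
    · rcases h3 with h3 | h3
      · have := Finset.card_lt_card h3
        simp only
        omega
      · exact absurd (norm_minSubgrad_le_of_not_releaseTest hε htest' h3) hlarge'

theorem exists_GCG3Step (hA : A.PosSemidef) (hτ : 0 ≤ τ)
    (hopt : ∃ x, IsOptimal A b τ x) (hε : 0 ≤ ε) (hlarge : ¬ ‖minSubgrad A b τ s.x‖ ≤ ε) :
    ∃ s', GCG3Step A b τ ρ ε s s' := by
  by_cases htest : ReleaseTest A b τ s.eta s.x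
  · by_cases hC : ∃ S ∈ s.C, S ⊆ idxZero s.x
    · exact ⟨_, .raise s htest hC⟩
    · exact ⟨_, .lineSearch s htest hC
        (projSubgrad_curvature_pos hA hτ hopt htest.projSubgrad_ne_zero).ne'⟩
  · obtain ⟨y, hy⟩ := exists_TPCG1Returns (δ := ε / max (√(n * s.eta)) 1) hA hopt hε
      (by positivity) htest hlarge
    exact ⟨_, .cg s y htest hy⟩

/-- `η̂` is increased at most `⌈(log η* - log η₀) / log ρ⌉` times. -/
theorem GCG3Invariant.succ_le_gcg3Bound (hη0 : 0 < η0) (hρ : 1 < ρ)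
    (h : GCG3Invariant A b τ x0 η0 ρ ε ηs k j s) : (k : ℤ) + 1 ≤ gcg3Bound n ηs η0 ρ := by
  have hphase : (phaseBound n : ℤ) = 1 + ((n : ℤ) + 2) * (2 ^ n - 1) := by
    rw [phaseBound]
    push_cast [Nat.one_le_two_pow]
    ring
  have h1 : ((k : ℤ) + 1) ≤ ((j : ℤ) + 1) * phaseBound n := by exact_mod_cast h.succ_le
  rw [gcg3Bound, ← hphase]
  refine h1.trans (mul_le_mul_of_nonneg_right ?_ (Int.natCast_nonneg _))
  have heta := h.eta_pos hη0 hρ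
  rcases h.eta_lt with rfl | hlt
  · split_ifs <;> simp
  · have hηs' : 0 < ηs := pos_of_mul_pos_right (heta.trans hlt) (by linarith)
    rw [if_neg hηs'.ne']
    refine le_max_of_le_left (add_le_add_left ?_ 1)
    have hlogρ := Real.log_pos hρ
    rw [h.eta_eq] at hlt
    have h2 := Real.log_lt_log (by positivity) hlt
    rw [Real.log_mul (by positivity) (by positivity), Real.log_mul (by positivity) hηs'.ne',
      Real.log_pow] at h2
    -- From `η₀ρʲ < ρη*`; strictness gives `j ≤ ⌈·⌉`, so there are at most `⌈·⌉ + 1` phases.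
    have h3 : ((j : ℤ) - 1 : ℤ) < ⌈(Real.log ηs - Real.log η0) / Real.log ρ⌉ := by
      rw [Int.lt_ceil, lt_div_iff₀ hlogρ]
      push_cast
      linarith
    omega

/-- Here `m` is the remaining iteration budget; the invariant forbids exhausting it, so the
recursion must end at the stopping test. -/
theorem GCG3Invariant.exists_run (hA : A.PosSemidef) (hτ : 0 ≤ τ)
    (hopt : ∃ x, IsOptimal A b τ x) (hη0 : 0 < η0) (hρ : 1 < ρ) (hε : 0 ≤ ε)
    (hηs : ErrorBound A b τ x0 ηs) (m : ℕ) :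
    ∀ {k j : ℕ} {s : GCG3State n}, GCG3Invariant A b τ x0 η0 ρ ε ηs k j s →
      gcg3Bound n ηs η0 ρ ≤ k + m →
      ∃ (K : ℕ) (S : ℕ → GCG3State n), S 0 = s ∧
        (∀ i < K, ¬ ‖minSubgrad A b τ (S i).x‖ ≤ ε ∧ GCG3Step A b τ ρ ε (S i) (S (i + 1))) ∧
        ‖minSubgrad A b τ (S K).x‖ ≤ ε := by
  induction m with
  | zero =>
    intro k j s h hm
    have := h.succ_le_gcg3Bound hη0 hρ
    push_cast at hm
    omega
  | succ m ih =>
    intro k j s h hm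
    by_cases hlarge : ‖minSubgrad A b τ s.x‖ ≤ ε
    · exact ⟨0, fun _ => s, rfl, by simp, hlarge⟩
    · obtain ⟨s', hs'⟩ := exists_GCG3Step (ρ := ρ) hA hτ hopt hε hlarge
      obtain ⟨j', h'⟩ := h.step hA hτ hopt hη0 hρ hε hηs hlarge hs'
      obtain ⟨K, S, hS0, hS, hSK⟩ := ih h' (by push_cast at hm ⊢; omega)
      refine ⟨K + 1, fun i => Nat.casesOn i s S, rfl, fun i hi => ?_, hSK⟩
      cases i with
      | zero => exact ⟨hlarge, show GCG3Step A b τ ρ ε s (S 0) by rw [hS0]; exact hs'⟩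
      | succ i => exact hS i (by omega)

end

theorem mainTheorem4 (n : ℕ) (A : Matrix (Fin n) (Fin n) ℝ) (hA : A.PosSemidef)
    (b : Fin n → ℝ) (τ : ℝ) (hτ : 0 ≤ τ) (hopt : ∃ x, IsOptimal A b τ x)
    (x0 : Fin n → ℝ) (η0 : ℝ) (hη0 : 0 < η0) (ρ : ℝ) (hρ : 1 < ρ) (ε : ℝ) (hε : 0 ≤ ε) :
    ∃ ηs : ℝ, IsLeast {η : ℝ | 0 ≤ η ∧ ErrorBound A b τ x0 η} ηs ∧
      (∃ (K : ℕ) (y : Fin n → ℝ), GCG3StopsAt A b τ x0 η0 ρ ε K y) ∧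
      ∀ (K : ℕ) (y : Fin n → ℝ), GCG3StopsAt A b τ x0 η0 ρ ε K y →
        (K : ℤ) + 1 ≤ gcg3Bound n ηs η0 ρ ∧
        (∃ s ∈ subdiffF A b τ y, ‖s‖ ≤ ε) ∧
        (ε = 0 → IsOptimal A b τ y) := by
  obtain ⟨ηs, hleast⟩ := exists_isLeast_errorBound hA b hτ hopt x0
  have hηs := hleast.1.2
  refine ⟨ηs, hleast, ?_, ?_⟩
  · obtain ⟨K, S, h0, hS, hK⟩ := GCG3Invariant.init.exists_run hA hτ hopt hη0 hρ hε hηs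
      (gcg3Bound n ηs η0 ρ).toNat (by push_cast; omega)
    exact ⟨K, _, S, h0, hS, hK, rfl⟩
  · rintro K y ⟨S, h0, hS, hK, rfl⟩
    -- The invariant holds along every run, so the bound does not depend on the run constructed for
    -- existence.
    have hinv : ∀ k ≤ K, ∃ j, GCG3Invariant A b τ x0 η0 ρ ε ηs k j (S k) := by
      intro k
      induction k with
      | zero => exact fun _ => ⟨0, h0 ▸ GCG3Invariant.init⟩
      | succ k ih =>
        intro hk
        obtain ⟨j, hj⟩ := ih (by omega)
        exact hj.step hA hτ hopt hη0 hρ hε hηs (hS k hk).1 (hS k hk).2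
    obtain ⟨j, hj⟩ := hinv K le_rfl
    refine ⟨hj.succ_le_gcg3Bound hη0 hρ, ⟨_, minSubgrad_mem_subdiffF hA b hτ _, hK⟩, ?_⟩
    rintro rfl
    exact isOptimal_of_minSubgrad_eq_zero hA hτ (norm_le_zero_iff.1 hK)

end
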